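/- Let $k$ be a finite field of characteristic $p$ and $\bar k$ an algebraic closure of $k$. Let $\Sigma$ be a set of prime numbers and let $\Sigma'$ be its complement in the set of all primes. For a field $\kappa$, write $\kappa^{\times}\{\Sigma'\}$ for the $\Sigma'$-primary part of the torsion of $\kappa^\times$, that is, the group of elements of $\kappa^\times$ of finite order whose order has all its prime divisors in $\Sigma'$. We say that $\Sigma$ is $k$-large if the field $k_{\Sigma'} = k(\zeta_{\ell^j} \mid \ell\in\Sigma'\setminus\{p\},\ j\ge 0)\subset\bar k$ is different from $\bar k$. Let $X$ be a proper, smooth, geometrically connected curve over $k$, let $f,g : X\to\mathbb P^1_k$ be non-constant $k$-morphisms, also regarded as rational functions on $X$, and put $U = X\setminus (f^{-1}(\infty)\cup g^{-1}(\infty))$. Let $m\ge 1$ be an integer. Consider the following properties: - $P^{(m)}_\Sigma(f,g)$: there are $a,c\in k^\times\{\Sigma'\}$ such that $f=a(1+cg)^m$; - $\overline P^{(m)}_\Sigma(f,g)$: there are $a,c\in \bar k^\times\{\Sigma'\}$ such that $f=a(1+cg)^m$ as rational functions on $X\times_k\bar k$; - $\overline Q^{(m)}_{1,\Sigma}(f,g)$: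 for all but finitely many closed points $x\in U$ there are $a_x,c_x\in\bar k^\times\{\Sigma'\}$ such that $f(x)=a_x(1+c_x g(x))^m$ in $\bar k$, where the residue field $k(x)$ is embedded in $\bar k$ over $k$ (the condition does not depend on the embedding). Then: (i) $P^{(m)}_\Sigma(f,g)\iff\overline P^{(m)}_\Sigma(f,g)\implies\overline Q^{(m)}_{1,\Sigma}(f,g)$. (ii) If $\Sigma$ is $k$-large, then $\overline Q^{(m)}_{1,\Sigma}(f,g)\implies\overline P^{(m)}_\Sigma(f,g)$. -/

import Mathlib

open CategoryTheory CategoryTheory.Limits AlgebraicGeometry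

universe u

noncomputable section

namespace CurvesOverFiniteFields

/-! ### Torsion of multiplicative groups and large sets of primes -/

/-- The `T`-primary part `G{T}` of the torsion of a commutative group `G`: the elements of finite
order whose order has all its prime divisors in `T`. -/
def primaryPart (T : Set Nat.Primes) (G : Type*) [CommGroup G] : Subgroup G where
  carrier := {a | IsOfFinOrder a ∧ ∀ ℓ : Nat.Primes, (ℓ : ℕ) ∣ orderOf a → ℓ ∈ T}
  one_mem' := ⟨IsOfFinOrder.one, fun ℓ h => absurd (by simpa using h) ℓ.2.one_lt.ne'⟩
  mul_mem' := by
    rintro a b ⟨ha, ha'⟩ ⟨hb, hb'⟩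
    refine ⟨ha.mul hb, fun ℓ h => ?_⟩
    have h1 : (ℓ : ℕ) ∣ orderOf a * orderOf b :=
      (h.trans (Commute.all a b).orderOf_mul_dvd_lcm).trans (Nat.lcm_dvd_mul _ _)
    exact (ℓ.2.dvd_mul.1 h1).elim (ha' ℓ) (hb' ℓ)
  inv_mem' := by
    rintro a ⟨ha, ha'⟩
    exact ⟨ha.inv, fun ℓ h => ha' ℓ (by simpa using h)⟩

/-- The field `k_T = k(ζ_{ℓ^j} | ℓ ∈ T, ℓ ≠ char k, j ≥ 0)`, as a subfield of `kbar`. -/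
def cyclotomicField (k kbar : Type*) [Field k] [Field kbar] [Algebra k kbar]
    (T : Set Nat.Primes) : IntermediateField k kbar :=
  IntermediateField.adjoin k
    {ζ : kbar | ∃ ℓ ∈ T, (ℓ : ℕ) ≠ ringChar k ∧ ∃ j : ℕ, ζ ^ ((ℓ : ℕ) ^ j) = 1}

/-- `T` is `k`-small if `k_T ≠ kbar`. -/
def IsSmall (k kbar : Type*) [Field k] [Field kbar] [Algebra k kbar] (T : Set Nat.Primes) : Prop :=
  cyclotomicField k kbar T ≠ ⊤

/-- `S` is `k`-large if its complement in the set of all primes is `k`-small. -/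
def IsLarge (k kbar : Type*) [Field k] [Field kbar] [Algebra k kbar] (S : Set Nat.Primes) : Prop :=
  IsSmall k kbar Sᶜ

/-! ### The projective line -/

section ProjectiveLine

variable (k : Type u) [Field k]

/-- The grading of `k[X₀, X₁]` by degree. -/
abbrev grading : ℕ → Submodule k (MvPolynomial (Fin 2) k) :=
  MvPolynomial.homogeneousSubmodule (Fin 2) k

instance gradingGradedRing : GradedRing (grading k) :=
  (MvPolynomial.gradedAlgebra : GradedAlgebra (MvPolynomial.homogeneousSubmodule (Fin 2) k))

/-- The projective line `Proj k[X₀, X₁]`. -/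
def P1 : Scheme.{u} := Proj (grading k)

/-- The structure morphism of the projective line. -/
def P1.toSpec : P1 k ⟶ Spec (.of k) :=
  Proj.toSpecZero (grading k) ≫ Spec.map (CommRingCat.ofHom (algebraMap k (grading k 0)))

/-- The affine line `ℙ¹ ∖ {∞}`, where `∞ = (1 : 0)`: the locus where `X₁` does not vanish. -/
def P1.finitePart : (P1 k).Opens := Proj.basicOpen (grading k) (MvPolynomial.X 1)

/-- The coordinate `X₀ / X₁` on `ℙ¹ ∖ {∞}`. -/
def P1.coord : Γ(P1 k, P1.finitePart k) :=
  Proj.awayToSection (grading k) (MvPolynomial.X 1)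
    (HomogeneousLocalization.Away.mk (grading k) (d := 1) (f := MvPolynomial.X 1)
      (MvPolynomial.isHomogeneous_X k 1) 1 (MvPolynomial.X 0)
      (MvPolynomial.isHomogeneous_X k 0))

end ProjectiveLine

/-! ### Functions on a `k`-scheme -/

section Functions

variable {k : Type u} [Field k]

/-- The constants `k → Γ(X, U)` on an open subscheme `U` of a `k`-scheme `s : X ⟶ Spec k`. -/
def const {X : Scheme.{u}} (s : X ⟶ Spec (.of k)) (U : X.Opens) : k →+* Γ(X, U) :=
  ((Scheme.ΓSpecIso (.of k)).inv ≫ s.appLE ⊤ U le_top).hom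

/-- A morphism is constant if it sends all points to one point. (For a `k`-morphism from a proper
geometrically connected smooth curve to `ℙ¹`, this says that it factors through a `k`-rational
point.) -/
def IsConstant {X Y : Scheme.{u}} (f : X ⟶ Y) : Prop := ∃ y : Y, ∀ x : X, f x = y

variable {X : Scheme.{u}} (f g : X ⟶ P1 k)

/-- The open subscheme `U = X ∖ (f⁻¹(∞) ∪ g⁻¹(∞))`. -/
def finiteLocus : X.Opens := f ⁻¹ᵁ P1.finitePart k ⊓ g ⁻¹ᵁ P1.finitePart k

/-- `f` as a regular function on `U`. -/
def fstFun : Γ(X, finiteLocus f g) :=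
  f.appLE (P1.finitePart k) (finiteLocus f g) inf_le_left (P1.coord k)

/-- `g` as a regular function on `U`. -/
def sndFun : Γ(X, finiteLocus f g) :=
  g.appLE (P1.finitePart k) (finiteLocus f g) inf_le_right (P1.coord k)

variable (s : X ⟶ Spec (.of k)) (kbar : Type u) [Field kbar] [Algebra k kbar]

/-- `P_S^{(m)}(f, g)`: there are `a, c ∈ kˣ{S'}` with `f = a (1 + c g) ^ m`, as functions on the
dense open subscheme `U` of `X`. -/
def PropP (S : Set Nat.Primes) (m : ℕ) : Prop :=
  ∃ a ∈ primaryPart Sᶜ kˣ, ∃ c ∈ primaryPart Sᶜ kˣ,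
    fstFun f g = const s _ (a : k) * (1 + const s _ (c : k) * sndFun f g) ^ m

/-- The geometric fibre `X ×ₖ kbar`. -/
def geomFibre : Scheme.{u} := pullback s (Spec.map (CommRingCat.ofHom (algebraMap k kbar)))

/-- The projection `X ×ₖ kbar ⟶ X`. -/
def geomFibre.proj : geomFibre s kbar ⟶ X := pullback.fst _ _

/-- The structure morphism `X ×ₖ kbar ⟶ Spec kbar`. -/
def geomFibre.toSpec : geomFibre s kbar ⟶ Spec (.of kbar) := pullback.snd _ _

/-- `P̄_S^{(m)}(f, g)`: there are `a, c ∈ kbarˣ{S'}` with `f = a (1 + c g) ^ m`, as functions on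
`U ×ₖ kbar`. -/
def PropPbar (S : Set Nat.Primes) (m : ℕ) : Prop :=
  ∃ a ∈ primaryPart Sᶜ kbarˣ, ∃ c ∈ primaryPart Sᶜ kbarˣ,
    (geomFibre.proj s kbar).app (finiteLocus f g) (fstFun f g) =
      const (geomFibre.toSpec s kbar) _ (a : kbar) *
        (1 + const (geomFibre.toSpec s kbar) _ (c : kbar) *
          (geomFibre.proj s kbar).app (finiteLocus f g) (sndFun f g)) ^ m

/-- The structure map `k → k(x)` of the residue field of a point of `U`. -/
def toResidue (U : X.Opens) (x : X) (hx : x ∈ U) : k →+* X.residueField x :=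
  (X.evaluation U x hx).hom.comp (const s U)

/-- The pointwise relation at `x ∈ U`: after embedding `k(x)` into `kbar` over `k`, there are
`a_x, c_x ∈ kbarˣ{S'}` with `f(x) = a_x (1 + c_x g(x)) ^ m`. (The choice of the embedding does not
matter, as `kbarˣ{S'}` is stable under the automorphisms of `kbar` over `k`.) -/
def RelAt (S : Set Nat.Primes) (m : ℕ) (x : X) (hx : x ∈ finiteLocus f g) : Prop :=
  ∃ ι : X.residueField x →+* kbar,
    ι.comp (toResidue s (finiteLocus f g) x hx) = algebraMap k kbar ∧
    ∃ a ∈ primaryPart Sᶜ kbarˣ, ∃ c ∈ primaryPart Sᶜ kbarˣ,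
      ι (X.evaluation _ x hx (fstFun f g)) =
        (a : kbar) * (1 + (c : kbar) * ι (X.evaluation _ x hx (sndFun f g))) ^ m

/-- `Q̄_{1,S}^{(m)}(f, g)`: the pointwise relation holds at all but finitely many closed points
`x ∈ U`. -/
def PropQbar (S : Set Nat.Primes) (m : ℕ) : Prop :=
  {x : X | IsClosed {x} ∧
    ∃ hx : x ∈ finiteLocus f g, ¬ RelAt f g s kbar S m x hx}.Finite

end Functions

end CurvesOverFiniteFields

end

/-! Write q = #k. Extending constants and evaluating a relation at points is formal, so the content
lies in the descent from `PropPbar` to `PropP` and in the pointwise criterion (ii).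

Descent: applying Frobenius to a relation at geometric points gives a relation at the conjugate
points with conjugate constants. Since g takes infinitely many values and a polynomial a(1 + cX)^m
with a, c nonzero determines a and c, both constants are fixed by Frobenius and lie in k. The
implication from `PropPbar` to `PropQbar` then passes through `PropP`.

Criterion: the torsion constants all lie in a proper subfield of kbar, so some prime power l^e
divides none of their degrees over k (`exists_prime_pow_not_dvd_period`). On an affine open of U, g
is transcendental, and almost every t in kbar is the value of g at a point defined over the field of
degree deg(t)·d, with d independent of t (`exists_algHom_apply_eq`). Take t of degree l^(j+1) with j
large. If y = a(1 + ct)^m at such a point, conjugating a and c over the field of the point gives a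
second polynomial with the same value at t. The difference has degree at most m and coefficients in
a field whose degree l^e does not divide, while t has degree at least l^m > m over that field; so
the difference is zero and a, c lie in the field of the point (`mem_periodicField_of_eq_linearPow`).
As l^e does not divide their degrees, they even lie in the fixed finite field of degree d·l^e. By
pigeonhole one pair (a, c) serves infinitely many points (`exists_infinite_setOf_algHom`). Affine
opens of the geometric fibre have Dedekind coordinate rings, where a function with infinitely many
zeros vanishes; hence f = a(1 + cg)^m. -/

/-! ### Local rings and integrality of smooth curves -/

open IsLocalRing in
/-- A Noetherian local ring whose maximal ideal is generated by zero or by a nonzerodivisor is a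
domain. -/
theorem IsLocalRing.isDomain_of_maximalIdeal_eq_span {O : Type*} [CommRing O] [IsLocalRing O]
    [IsNoetherianRing O] {t : O} (ht : maximalIdeal O = Ideal.span {t})
    (ht' : t = 0 ∨ t ∈ nonZeroDivisors O) : IsDomain O := by
  -- By Krull's intersection theorem x ≠ 0 leaves some power of the maximal ideal; the last power
  -- containing x gives the exponent of t.
  have key : ∀ x : O, x ≠ 0 → ∃ (n : ℕ) (v : O), IsUnit v ∧ x = v * t ^ n := by
    intro x hx
    have hinf := Ideal.iInf_pow_eq_bot_of_isLocalRing (maximalIdeal O) (Ideal.IsPrime.ne_top')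
    have : ∃ n, x ∉ (maximalIdeal O) ^ n := by
      by_contra! h
      exact hx (by simpa [hinf] using (Submodule.mem_iInf _).2 h)
    classical
    have h0 : Nat.find this ≠ 0 := by
      intro h
      have := Nat.find_spec this
      rw [h] at this
      simp at this
    obtain ⟨n, hn⟩ := Nat.exists_eq_succ_of_ne_zero h0
    have h1 : x ∈ (maximalIdeal O) ^ n := by
      by_contra h
      exact Nat.find_min this (by omega) h
    have h2 : x ∉ (maximalIdeal O) ^ (n + 1) := by
      have := Nat.find_spec this
      rwa [hn] at this
    rw [ht, Ideal.span_singleton_pow, Ideal.mem_span_singleton'] at h1 h2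
    obtain ⟨v, rfl⟩ := h1
    refine ⟨n, v, ?_, rfl⟩
    by_contra hv
    have hv' : v ∈ maximalIdeal O := hv
    rw [ht, Ideal.mem_span_singleton'] at hv'
    obtain ⟨w, rfl⟩ := hv'
    exact h2 ⟨w, by ring⟩
  have : NoZeroDivisors O := by
    refine ⟨fun {a b} hab => ?_⟩
    by_contra! h
    obtain ⟨n, v, hv, rfl⟩ := key a h.1
    obtain ⟨k, w, hw, rfl⟩ := key b h.2
    have h3 : t ^ (n + k) = 0 := by
      have : (v * w) * t ^ (n + k) = 0 := by rw [← hab]; ring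
      exact ((hv.mul hw).mul_right_eq_zero).1 this
    rcases ht' with rfl | ht'
    · by_cases hn : n = 0 <;> by_cases hk : k = 0 <;> simp_all
    · exact one_ne_zero (α := O) (by
        simpa [h3] using (mul_right_mem_nonZeroDivisors_eq_zero_iff (x := (1 : O)) (pow_mem ht' (n + k))).1)
  exact NoZeroDivisors.to_isDomain O

/-- The local rings of an étale algebra over a principal ideal domain are domains with principal
maximal ideal. -/
theorem Algebra.Etale.isDomain_and_isPrincipal (R S : Type*) [CommRing R] [IsDomain R]
    [IsPrincipalIdealRing R] [CommRing S] [Algebra R S] [Algebra.Etale R S] (q : Ideal S) [q.IsPrime]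
    : IsDomain (Localization.AtPrime q) ∧
      (IsLocalRing.maximalIdeal (Localization.AtPrime q)).IsPrincipal := by
  have hN : IsNoetherianRing S := Algebra.FiniteType.isNoetherianRing R S
  have hN' : IsNoetherianRing (Localization.AtPrime q) :=
    IsLocalization.isNoetherianRing q.primeCompl _ hN
  let p := q.under R
  let := Localization.AtPrime.algebraOfLiesOver p q
  -- Unramifiedness makes a generator π of the prime below generate the maximal ideal above;
  -- flatness keeps π a nonzerodivisor when π ≠ 0.
  have hmap := ((Algebra.isUnramifiedAt_iff_map_eq R p q).1 inferInstance).2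
  obtain ⟨π, hπ⟩ := IsPrincipalIdealRing.principal p
  have hp : p = Ideal.span {π} := hπ
  rw [hp, Ideal.map_span, Set.image_singleton] at hmap
  refine ⟨IsLocalRing.isDomain_of_maximalIdeal_eq_span hmap.symm ?_, ⟨⟨_, hmap.symm⟩⟩⟩
  by_cases h0 : π = 0
  · exact Or.inl (by simp [h0])
  · right
    have hfl : Module.Flat R S := inferInstance
    have : Module.Flat R (Localization.AtPrime q) := Module.Flat.trans R S _
    have hr := Module.Flat.isSMulRegular_of_nonZeroDivisors (M := Localization.AtPrime q)
      (mem_nonZeroDivisors_of_ne_zero h0)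
    rw [mem_nonZeroDivisors_iff_right]
    intro x hx
    refine hr ?_
    simp only [Algebra.smul_def, mul_zero]
    rw [mul_comm, hx]

/-- The local rings of a standard smooth algebra of relative dimension one over a field are domains
with principal maximal ideal. -/
theorem RingHom.IsStandardSmoothOfRelativeDimension.isDomain_and_isPrincipal {K S : Type*}
    [CommRing K] (hK : IsField K) [CommRing S] {φ : K →+* S}
    (hφ : φ.IsStandardSmoothOfRelativeDimension 1) (q : Ideal S) [q.IsPrime] :
    IsDomain (Localization.AtPrime q) ∧
      (IsLocalRing.maximalIdeal (Localization.AtPrime q)).IsPrincipal := by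
  let := hK.toField
  -- Locally a smooth curve is étale over the affine line, whose coordinate ring is principal.
  obtain ⟨g, -, hg⟩ := hφ.exists_etale_mvPolynomial
  have : IsPrincipalIdealRing (MvPolynomial (Fin 1) K) :=
    IsPrincipalIdealRing.of_surjective
      (MvPolynomial.uniqueAlgEquiv K (Fin 1)).symm.toRingEquiv.toRingHom
      (MvPolynomial.uniqueAlgEquiv K (Fin 1)).symm.surjective
  let := g.toAlgebra
  have : Algebra.Etale (MvPolynomial (Fin 1) K) S := hg
  exact Algebra.Etale.isDomain_and_isPrincipal (MvPolynomial (Fin 1) K) S q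

theorem IsLocalRing.isPrincipal_maximalIdeal_of_ringEquiv {R S : Type*} [CommRing R] [CommRing S]
    [IsLocalRing R] [IsLocalRing S] (e : R ≃+* S) (h : (maximalIdeal R).IsPrincipal) :
    (maximalIdeal S).IsPrincipal := by
  rw [← map_ringEquiv_maximalIdeal e]
  obtain ⟨a, ha⟩ := h
  exact ⟨e a, by
    rw [ha]; simp [Ideal.submodule_span_eq, Ideal.map_span]⟩

namespace AlgebraicGeometry

/-- The local rings of a smooth curve over a field are domains with principal maximal ideal. -/
theorem SmoothOfRelativeDimension.isDomain_and_isPrincipal_stalk {K : Type u} [Field K]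
    {X : Scheme.{u}} (s : X ⟶ Spec (.of K)) [SmoothOfRelativeDimension 1 s] (x : X) :
    IsDomain (X.presheaf.stalk x) ∧
      (IsLocalRing.maximalIdeal (X.presheaf.stalk x)).IsPrincipal := by
  obtain ⟨U, hU, V, hV, hx, e, hs⟩ :=
    SmoothOfRelativeDimension.exists_isStandardSmoothOfRelativeDimension (n := 1) (f := s) x
  have hUtop : U = ⊤ := by
    ext y
    have : y = s x := Subsingleton.elim (α := PrimeSpectrum K) _ _
    simpa [this] using e hx
  subst hUtop
  have hK : IsField Γ(Spec (.of K), ⊤) :=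
    MulEquiv.isField (Field.toIsField K)
      (Scheme.ΓSpecIso (.of K)).commRingCatIsoToRingEquiv.toMulEquiv
  obtain ⟨h1, h2⟩ := hs.isDomain_and_isPrincipal hK (hV.primeIdealOf ⟨x, hx⟩).asIdeal
  let := X.presheaf.algebra_section_stalk (⟨x, hx⟩ : V)
  have : IsLocalization.AtPrime (X.presheaf.stalk x) (hV.primeIdealOf ⟨x, hx⟩).asIdeal :=
    hV.isLocalization_stalk ⟨x, hx⟩
  let e' := (IsLocalization.algEquiv (hV.primeIdealOf ⟨x, hx⟩).asIdeal.primeCompl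
    (Localization.AtPrime (hV.primeIdealOf ⟨x, hx⟩).asIdeal) (X.presheaf.stalk x)).toRingEquiv
  exact ⟨e'.symm.toMulEquiv.isDomain _, IsLocalRing.isPrincipal_maximalIdeal_of_ringEquiv e' h2⟩

/-- The closure of one irreducible open U is open: an irreducible open V around a point of the
closure meets U, so V lies in the closure of V ∩ U. By connectedness the closure is the whole space.
-/
theorem irreducibleSpace_of_forall_exists_isIrreducible {T : Type*} [TopologicalSpace T]
    [ConnectedSpace T] (h : ∀ x : T, ∃ U : Set T, IsOpen U ∧ x ∈ U ∧ IsIrreducible U) :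
    IrreducibleSpace T := by
  obtain ⟨x⟩ := (inferInstance : Nonempty T)
  obtain ⟨U, hU, hxU, hUi⟩ := h x
  have hclo : IsOpen (closure U) := by
    rw [isOpen_iff_forall_mem_open]
    intro y hy
    obtain ⟨V, hV, hyV, hVi⟩ := h y
    refine ⟨V, ?_, hV, hyV⟩
    have hne := mem_closure_iff.1 hy V hV hyV
    exact (subset_closure_inter_of_isPreirreducible_of_isOpen hVi.2 hU hne).trans
      (closure_mono Set.inter_subset_right)
  have huniv : closure U = Set.univ :=
    IsClopen.eq_univ ⟨isClosed_closure, hclo⟩ ⟨x, subset_closure hxU⟩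
  rw [irreducibleSpace_def]
  exact (show closure U = (⊤ : Set T) from huniv) ▸ hUi.closure

/-- A connected smooth curve over a field is integral. -/
theorem SmoothOfRelativeDimension.isIntegral {K : Type u} [Field K]
    {X : Scheme.{u}} (s : X ⟶ Spec (.of K)) [SmoothOfRelativeDimension 1 s] [ConnectedSpace X] :
    IsIntegral X := by
  have hd (x : X) : IsDomain (X.presheaf.stalk x) := (isDomain_and_isPrincipal_stalk s x).1
  have : Smooth s := SmoothOfRelativeDimension.smooth 1 s
  have : IsLocallyNoetherian X := LocallyOfFiniteType.isLocallyNoetherian s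
  have : IsReduced X := by
    have (x : X) : _root_.IsReduced (X.presheaf.stalk x) := inferInstance
    exact isReduced_of_isReduced_stalk X
  have : IrreducibleSpace X := by
    refine irreducibleSpace_of_forall_exists_isIrreducible fun x => ?_
    -- On a locally Noetherian scheme the sections of a small affine neighbourhood embed in the
    -- stalk, here a domain, so that neighbourhood is irreducible.
    obtain ⟨U, hx, hU, hinj⟩ := X.exists_germ_injective x
    have : IsDomain Γ(X, U) := hinj.isDomain (X.presheaf.germ U x hx).hom
    refine ⟨U, U.2, hx, ?_⟩
    have h1 : IsIrreducible (Set.univ : Set (PrimeSpectrum Γ(X, U))) :=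
      IrreducibleSpace.isIrreducible_univ _
    have := h1.image hU.fromSpec hU.fromSpec.continuous.continuousOn
    have h2 := hU.range_fromSpec
    rw [← Set.image_univ] at h2
    exact h2 ▸ this
  exact isIntegral_of_irreducibleSpace_of_isReduced X

end AlgebraicGeometry

/-! ### Frobenius orbits in an algebraic closure of a finite field -/

namespace FiniteField

open Function Polynomial

/-- The Frobenius endomorphism `x ↦ x ^ #k` of an extension of a finite field `k`. -/
noncomputable def frob (k L : Type*) [Field k] [Finite k] [Field L] [Algebra k L] : L →ₐ[k] L :=
  let := Fintype.ofFinite k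
  frobeniusAlgHom k L

variable (k : Type*) {L : Type*} [Field k] [Finite k] [Field L] [Algebra k L]

theorem frob_apply (x : L) : frob k L x = x ^ Nat.card k := by
  let := Fintype.ofFinite k
  simp [frob, Nat.card_eq_fintype_card]

theorem iterate_frob_apply (n : ℕ) (x : L) : (frob k L)^[n] x = x ^ (Nat.card k) ^ n := by
  induction n with
  | zero => simp
  | succ n ih => rw [iterate_succ_apply', ih, frob_apply, pow_succ, pow_mul]

theorem pow_frob_apply (n : ℕ) (x : L) : (frob k L ^ n) x = (frob k L)^[n] x := by
  rw [AlgHom.coe_pow]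

theorem isPeriodicPt_frob_iff {n : ℕ} {x : L} :
    IsPeriodicPt (frob k L) n x ↔ (frob k L ^ n) x = x := by
  rw [pow_frob_apply]; rfl

theorem isPeriodicPt_frob_iff_pow {n : ℕ} {x : L} :
    IsPeriodicPt (frob k L) n x ↔ x ^ (Nat.card k) ^ n - x = 0 := by
  rw [sub_eq_zero, ← iterate_frob_apply]; rfl

/-- The elements fixed by a power of the Frobenius form an intermediate field. -/
noncomputable def periodicField (L : Type*) [Field L] [Algebra k L] (n : ℕ) :
    IntermediateField k L :=
  IntermediateField.mk ((AlgHom.equalizer (frob k L ^ n) (AlgHom.id k L))) (fun x hx => by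
    have hx' : (frob k L ^ n) x = x := hx
    change (frob k L ^ n) x⁻¹ = x⁻¹
    rw [map_inv₀, hx'])

variable {k}

theorem mem_periodicField {n : ℕ} {x : L} :
    x ∈ periodicField k L n ↔ IsPeriodicPt (frob k L) n x := (isPeriodicPt_frob_iff k).symm

theorem mem_periodicField_iff_isRoot {n : ℕ} {x : L} :
    x ∈ periodicField k L n ↔ (X ^ (Nat.card k) ^ n - X : L[X]).IsRoot x := by
  rw [mem_periodicField, isPeriodicPt_frob_iff_pow]
  simp

theorem one_lt_natCard_pow {n : ℕ} (hn : 0 < n) : 1 < (Nat.card k) ^ n :=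
  Nat.one_lt_pow hn.ne' Finite.one_lt_card

theorem coe_periodicField_eq {n : ℕ} (hn : 0 < n) :
    (periodicField k L n : Set L) = (X ^ (Nat.card k) ^ n - X : L[X]).rootSet L := by
  ext x
  rw [SetLike.mem_coe, mem_periodicField_iff_isRoot, mem_rootSet]
  simp [FiniteField.X_pow_card_sub_X_ne_zero L (one_lt_natCard_pow (k := k) hn), sub_eq_zero]

theorem finite_periodicField {n : ℕ} (hn : 0 < n) : (periodicField k L n : Set L).Finite := by
  rw [coe_periodicField_eq hn]
  exact rootSet_finite _ _

theorem ncard_periodicField_le {n : ℕ} (hn : 0 < n) :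
    (periodicField k L n : Set L).ncard ≤ (Nat.card k) ^ n := by
  rw [coe_periodicField_eq hn]
  exact (ncard_rootSet_le _ _).trans
    (FiniteField.X_pow_card_sub_X_natDegree_eq L (one_lt_natCard_pow hn)).le

theorem periodicField_mono {n n' : ℕ} (h : n ∣ n') : periodicField k L n ≤ periodicField k L n' :=
  fun _ hx => mem_periodicField.2 ((mem_periodicField.1 hx).trans_dvd h)

/-- A finite subextension is the fixed field of the corresponding power of the Frobenius. -/
theorem eq_periodicField_finrank (E : IntermediateField k L) [FiniteDimensional k E] :
    E = periodicField k L (Module.finrank k E) := by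
  have : Finite E := Module.finite_of_finite k
  have hcard : Nat.card E = (Nat.card k) ^ Module.finrank k E := Module.natCard_eq_pow_finrank
  -- Elements of E are roots of X^(q^n) - X with n = [E : k], and E already has q^n elements, as
  -- many as there can be roots.
  have hle : (E : Set L) ⊆ periodicField k L (Module.finrank k E) := by
    intro x hx
    rw [SetLike.mem_coe, mem_periodicField, isPeriodicPt_frob_iff_pow, sub_eq_zero, ← hcard]
    let := Fintype.ofFinite E
    rw [Nat.card_eq_fintype_card]
    exact congrArg (Subtype.val) (FiniteField.pow_card (⟨x, hx⟩ : E))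
  apply SetLike.coe_injective
  refine Set.eq_of_subset_of_ncard_le hle ?_ (finite_periodicField Module.finrank_pos)
  refine (ncard_periodicField_le Module.finrank_pos).trans ?_
  rw [← hcard]
  exact (Nat.card_coe_set_eq (E : Set L)).le

variable (k) in
/-- The degree of `x` over the finite field `k`, as the size of the Frobenius orbit. -/
noncomputable def period (x : L) : ℕ := minimalPeriod (frob k L) x

theorem mem_periodicField_iff_dvd {n : ℕ} {x : L} :
    x ∈ periodicField k L n ↔ period k x ∣ n := by
  rw [mem_periodicField]; exact isPeriodicPt_iff_minimalPeriod_dvd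

theorem period_dvd_finrank {x : L} {E : IntermediateField k L} [FiniteDimensional k E]
    (hx : x ∈ E) : period k x ∣ Module.finrank k E := by
  rw [← mem_periodicField_iff_dvd, ← eq_periodicField_finrank E]; exact hx

/-- The field of degree l^(j+1) over k has more elements than the one of degree l^j; an element of
the difference has degree dividing l^(j+1) but not l^j. -/
theorem exists_period_eq_prime_pow [IsAlgClosed L] {l : ℕ} (hl : l.Prime) (j : ℕ) :
    ∃ x : L, period k x = l ^ (j + 1) := by
  obtain ⟨p, hp⟩ := CharP.exists k
  have hp0 : p ∣ Nat.card k := by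
    let := Fintype.ofFinite k
    rw [Nat.card_eq_fintype_card, ← CharP.cast_eq_zero_iff k, FiniteField.cast_card_eq_zero]
  have hpL : CharP L p := (Algebra.charP_iff k L p).1 hp
  have hcard : (periodicField k L (l ^ (j + 1)) : Set L).ncard =
      (Nat.card k) ^ (l ^ (j + 1)) := by
    have hpos : 0 < l ^ (j + 1) := pow_pos hl.pos _
    have hsep : (X ^ (Nat.card k) ^ (l ^ (j + 1)) - X : L[X]).Separable :=
      galois_poly_separable p _ (hp0.trans (dvd_pow_self _ hpos.ne'))
    have := card_rootSet_eq_natDegree (K := L) hsep (IsAlgClosed.splits _)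
    rw [coe_periodicField_eq hpos, ← Nat.card_coe_set_eq, Nat.card_eq_fintype_card, this,
      FiniteField.X_pow_card_sub_X_natDegree_eq L (one_lt_natCard_pow hpos)]
  have hlt : (periodicField k L (l ^ j) : Set L).ncard <
      (periodicField k L (l ^ (j + 1)) : Set L).ncard := by
    rw [hcard]
    exact (ncard_periodicField_le (pow_pos hl.pos _)).trans_lt
      (Nat.pow_lt_pow_right Finite.one_lt_card (Nat.pow_lt_pow_right hl.one_lt (Nat.lt_succ_self j)))
  obtain ⟨x, hx, hx'⟩ := Set.exists_mem_notMem_of_ncard_lt_ncard hlt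
    (finite_periodicField (pow_pos hl.pos _))
  have : Fact l.Prime := ⟨hl⟩
  exact ⟨x, minimalPeriod_eq_prime_pow (fun h => hx' (mem_periodicField.2 h))
    (mem_periodicField.1 hx)⟩

/-- The q^n-power Frobenius fixes the coefficients of Q, so the orbit of z under it consists of
distinct roots of Q. The left-hand side is the degree of z over the field with q^n elements. -/
theorem minimalPeriod_le_natDegree {Q : L[X]} (hQ : Q ≠ 0) {n : ℕ}
    (hcoeff : ∀ i, Q.coeff i ∈ periodicField k L n) {z : L} (hz : Q.IsRoot z) :
    minimalPeriod ((frob k L)^[n]) z ≤ Q.natDegree := by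
  classical
  have hmap : Q.map (frob k L ^ n : L →ₐ[k] L).toRingHom = Q := by
    ext i
    rw [coeff_map]
    exact (isPeriodicPt_frob_iff k).1 (mem_periodicField.1 (hcoeff i))
  have hroot : ∀ i, Q.IsRoot (((frob k L)^[n])^[i] z) := by
    intro i
    induction i with
    | zero => exact hz
    | succ i ih =>
      rw [iterate_succ_apply', ← pow_frob_apply]
      have := ih.map (f := (frob k L ^ n : L →ₐ[k] L).toRingHom)
      rwa [hmap] at this
  have hsub : (Finset.range (minimalPeriod ((frob k L)^[n]) z)).image
      (fun i => ((frob k L)^[n])^[i] z) ⊆ Q.roots.toFinset := by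
    intro y hy
    obtain ⟨i, -, rfl⟩ := Finset.mem_image.1 hy
    exact Multiset.mem_toFinset.2 ((mem_roots hQ).2 (hroot i))
  have h1 := Finset.card_le_card hsub
  rw [Finset.card_image_of_injOn, Finset.card_range] at h1
  · exact h1.trans ((Multiset.toFinset_card_le _).trans (card_roots' Q))
  · intro a ha b hb hab
    exact iterate_injOn_Iio_minimalPeriod (by simpa using ha) (by simpa using hb) hab

variable [Algebra.IsAlgebraic k L]

theorem mem_periodicPts_frob (x : L) : x ∈ periodicPts (frob k L) := by
  have hx : IsIntegral k x := Algebra.IsIntegral.isIntegral x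
  have := IntermediateField.adjoin.finiteDimensional hx
  have h := eq_periodicField_finrank (IntermediateField.adjoin k {x})
  exact mk_mem_periodicPts Module.finrank_pos
    (mem_periodicField.1 (h ▸ IntermediateField.mem_adjoin_simple_self k x))

theorem period_pos (x : L) : 0 < period k x :=
  minimalPeriod_pos_of_mem_periodicPts (mem_periodicPts_frob x)

/-- The degrees of the elements of a proper subfield of `L` are not divisible by arbitrarily high
powers of a suitable prime number. -/
theorem exists_prime_pow_not_dvd_period {K : IntermediateField k L} (hK : K ≠ ⊤) :
    ∃ (l e : ℕ), l.Prime ∧ ∀ x ∈ K, ¬ l ^ e ∣ period k x := by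
  by_contra! H
  refine hK (eq_top_iff.2 fun z _ => ?_)
  -- Otherwise K contains elements of degree divisible by any given prime power. Composita of the
  -- fields they generate have degree divisible by any given n, so K would contain every finite
  -- subfield.
  have key : ∀ n : ℕ, n ≠ 0 → ∃ E : IntermediateField k L, FiniteDimensional k E ∧ E ≤ K ∧
      n ∣ Module.finrank k E := by
    have adj (x : L) (hx : x ∈ K) : ∃ E : IntermediateField k L, FiniteDimensional k E ∧ E ≤ K ∧
        period k x ∣ Module.finrank k E := by
      have := IntermediateField.adjoin.finiteDimensional (Algebra.IsIntegral.isIntegral (R := k) x)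
      exact ⟨_, this, by simpa using hx,
        period_dvd_finrank (IntermediateField.mem_adjoin_simple_self k x)⟩
    intro n
    induction n using Nat.recOnPosPrimePosCoprime with
    | zero => exact fun h => absurd rfl h
    | one =>
      intro _
      obtain ⟨E, h1, h2, -⟩ := adj 1 K.one_mem
      exact ⟨E, h1, h2, one_dvd _⟩
    | prime_pow p n hp hn =>
      intro _
      obtain ⟨x, hx, hd⟩ := H p n hp
      obtain ⟨E, h1, h2, h3⟩ := adj x hx
      exact ⟨E, h1, h2, hd.trans h3⟩
    | coprime a b ha hb hab iha ihb =>
      intro _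
      obtain ⟨E, h1, h2, h3⟩ := iha (by omega)
      obtain ⟨E', h1', h2', h3'⟩ := ihb (by omega)
      exact ⟨E ⊔ E', inferInstance, sup_le h2 h2', hab.mul_dvd_of_dvd_of_dvd
        (h3.trans (IntermediateField.finrank_dvd_of_le_right le_sup_left))
        (h3'.trans (IntermediateField.finrank_dvd_of_le_right le_sup_right))⟩
  obtain ⟨E, h1, h2, h3⟩ := key _ (period_pos (k := k) z).ne'
  refine h2 ?_
  rw [eq_periodicField_finrank E]
  exact mem_periodicField_iff_dvd.2 h3

/-- The degree of z over the field with q^n elements is at most deg Q, hence divides (deg Q)!. The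
factorial makes the bound depend on deg Q alone. -/
theorem mem_periodicField_mul_factorial {Q : L[X]} (hQ : Q ≠ 0) {n : ℕ}
    (hcoeff : ∀ i, Q.coeff i ∈ periodicField k L n) {z : L} (hz : Q.IsRoot z) :
    z ∈ periodicField k L (n * (Q.natDegree).factorial) := by
  have h := minimalPeriod_le_natDegree hQ hcoeff hz
  have hz' : z ∈ periodicPts ((frob k L)^[n]) := by
    obtain ⟨r, hr, h⟩ := mem_periodicPts.1 (mem_periodicPts_frob (k := k) z)
    exact mk_mem_periodicPts hr (h.iterate n)
  have h2 := (isPeriodicPt_minimalPeriod ((frob k L)^[n]) z).trans_dvd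
    (Nat.dvd_factorial (minimalPeriod_pos_of_mem_periodicPts hz') h)
  rw [mem_periodicField]
  rw [IsPeriodicPt, ← iterate_mul] at h2
  exact h2

/-- The quotient on the left is the degree of z over the field with q^n elements. -/
theorem period_le_natDegree_mul_gcd {Q : L[X]} (hQ : Q ≠ 0) {n : ℕ}
    (hcoeff : ∀ i, Q.coeff i ∈ periodicField k L n) {z : L} (hz : Q.IsRoot z) :
    period k z / (period k z).gcd n ≤ Q.natDegree := by
  have h := minimalPeriod_le_natDegree hQ hcoeff hz
  rwa [minimalPeriod_iterate_eq_div_gcd' (mem_periodicPts_frob z)] at h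

end FiniteField

/-! ### The relation `y = a (1 + c t) ^ m` at points of large degree -/

open Polynomial in
/-- The polynomial `a (1 + c X) ^ m`. -/
noncomputable def linearPow {L : Type*} [CommRing L] (a c : L) (m : ℕ) : L[X] :=
  C a * (1 + C c * X) ^ m

namespace FiniteField

open Function Polynomial

section

variable {L : Type*} [Field L]

@[simp]
theorem eval_linearPow (a c t : L) (m : ℕ) : (linearPow a c m).eval t = a * (1 + c * t) ^ m := by
  simp [linearPow]

theorem natDegree_linearPow_le (a c : L) (m : ℕ) : (linearPow a c m).natDegree ≤ m := by
  unfold linearPow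
  compute_degree

/-- The value at 0 recovers a, and the root -1/c recovers c. -/
theorem linearPow_injective {a c a' c' : L} {m : ℕ} (hm : 0 < m) (ha : a ≠ 0) (hc : c ≠ 0)
    (h : linearPow a c m = linearPow a' c' m) : a = a' ∧ c = c' := by
  have h0 := congrArg (Polynomial.eval 0) h
  have h1 := congrArg (Polynomial.eval (-c⁻¹)) h
  simp only [eval_linearPow, mul_zero, add_zero, one_pow, mul_one] at h0
  refine ⟨h0, ?_⟩
  rw [eval_linearPow, eval_linearPow, ← h0, mul_neg, mul_inv_cancel₀ hc, add_neg_cancel,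
    zero_pow hm.ne', mul_zero, eq_comm, mul_eq_zero_iff_left ha, pow_eq_zero_iff hm.ne'] at h1
  have h2 : c' * c⁻¹ = 1 := by linear_combination -h1
  exact ((mul_inv_eq_one₀ hc).1 h2).symm

theorem coeff_linearPow_mem {k : Type*} [Field k] [Algebra k L] {E : IntermediateField k L} {a c : L} (ha : a ∈ E) (hc : c ∈ E)
    (m i : ℕ) : (linearPow a c m).coeff i ∈ E := by
  have : linearPow a c m = (linearPow (⟨a, ha⟩ : E) ⟨c, hc⟩ m).map (algebraMap E L) := by
    simp [linearPow]
  rw [this, coeff_map]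
  exact ((linearPow (⟨a, ha⟩ : E) ⟨c, hc⟩ m).coeff i).2

end

variable {k : Type*} {L : Type*} [Field k] [Finite k] [Field L] [Algebra k L]

theorem pow_dvd_right_of_pow_dvd_mul {l : ℕ} (hl : l.Prime) {e m g r : ℕ}
    (h : l ^ (e + m) ∣ g * r) (he : ¬ l ^ e ∣ g) : l ^ m ∣ r := by
  obtain ⟨i, j, hij⟩ := (Nat.dvd_mul.1 h)
  obtain ⟨h1, h2, h3⟩ := hij
  obtain ⟨i', -, rfl⟩ := (Nat.dvd_prime_pow hl).1 (Dvd.intro _ h3)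
  obtain ⟨j', -, rfl⟩ := (Nat.dvd_prime_pow hl).1 (Dvd.intro_left _ h3)
  rw [← pow_add] at h3
  have h4 := Nat.pow_right_injective hl.two_le h3
  have h5 : i' < e := by
    by_contra! h
    exact he ((pow_dvd_pow l h).trans h1)
  exact (pow_dvd_pow l (by omega)).trans h2

theorem pow_dvd_or_pow_dvd_of_pow_dvd_lcm {l : ℕ} (hl : l.Prime) {e a b : ℕ} (ha : a ≠ 0)
    (hb : b ≠ 0) (h : l ^ e ∣ a.lcm b) : l ^ e ∣ a ∨ l ^ e ∣ b := by
  rw [hl.pow_dvd_iff_le_factorization (Nat.lcm_ne_zero ha hb), Nat.factorization_lcm ha hb] at h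
  rw [hl.pow_dvd_iff_le_factorization ha, hl.pow_dvd_iff_le_factorization hb]
  simpa using h

theorem dvd_mul_pow_of_not_pow_dvd {l : ℕ} (hl : l.Prime) {d n e j : ℕ} (hd : d ∣ n * l ^ j)
    (hd0 : d ≠ 0) (he : ¬ l ^ e ∣ d) : d ∣ n * l ^ e := by
  obtain ⟨i, d', hd', rfl⟩ := Nat.exists_eq_pow_mul_and_not_dvd hd0 l hl.ne_one
  have hi : i < e := by
    by_contra! h
    exact he ((pow_dvd_pow l h).trans (Dvd.intro _ rfl))
  have hcop : d'.Coprime (l ^ j) := ((Nat.Prime.coprime_iff_not_dvd hl).2 hd').symm.pow_right j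
  rw [mul_comm]
  exact mul_dvd_mul (hcop.dvd_of_dvd_mul_right ((Dvd.intro_left _ rfl).trans hd))
    (pow_dvd_pow l hi.le)

variable [Algebra.IsAlgebraic k L]

/-- If `y = a (1 + c t) ^ m` with `a, c` of degree not divisible by `l ^ e` and `t` of degree
divisible by `l ^ (e + m)`, then `a` and `c` lie in every finite field containing `y` and `t`. -/
theorem mem_periodicField_of_eq_linearPow {l e m N : ℕ} (hl : l.Prime) (hm : 0 < m) {a c t y : L}
    (ha : a ≠ 0) (hc : c ≠ 0) (hae : ¬ l ^ e ∣ period k a) (hce : ¬ l ^ e ∣ period k c)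
    (ht : l ^ (e + m) ∣ period k t) (hy : y = a * (1 + c * t) ^ m)
    (htN : t ∈ periodicField k L N) (hyN : y ∈ periodicField k L N) :
    a ∈ periodicField k L N ∧ c ∈ periodicField k L N := by
  -- σ generates the conjugations over the field of degree N; the aim is σ a = a and σ c = c. Since
  -- σ fixes t and y, t is a root of the difference of the two conjugate polynomials.
  set σ := (frob k L ^ N) with hσ
  set n := (period k a).lcm (period k c) with hn
  have hn0 : ¬ l ^ e ∣ n := fun h => by
    rcases pow_dvd_or_pow_dvd_of_pow_dvd_lcm hl (period_pos a).ne' (period_pos c).ne' h with h | h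
    exacts [hae h, hce h]
  have han : a ∈ periodicField k L n := mem_periodicField_iff_dvd.2 (Nat.dvd_lcm_left _ _)
  have hcn : c ∈ periodicField k L n := mem_periodicField_iff_dvd.2 (Nat.dvd_lcm_right _ _)
  have hσn : ∀ x ∈ periodicField k L n, σ x ∈ periodicField k L n := fun x hx => by
    rw [hσ, pow_frob_apply]
    exact mem_periodicField.2 ((mem_periodicField.1 hx).apply_iterate N)
  have hσt : σ t = t := (isPeriodicPt_frob_iff k).1 (mem_periodicField.1 htN)
  have hσy : σ y = y := (isPeriodicPt_frob_iff k).1 (mem_periodicField.1 hyN)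
  have key : linearPow a c m = linearPow (σ a) (σ c) m := by
    rw [← sub_eq_zero]
    by_contra hD
    set D := linearPow a c m - linearPow (σ a) (σ c) m with hDdef
    have hroot : D.IsRoot t := by
      rw [IsRoot, hDdef, eval_sub, eval_linearPow, eval_linearPow, ← hy, sub_eq_zero]
      have := congrArg σ hy
      rw [hσy] at this
      simpa [hσt] using this
    have hcoeff : ∀ i, D.coeff i ∈ periodicField k L n := fun i => by
      rw [hDdef, coeff_sub]
      exact sub_mem (coeff_linearPow_mem han hcn m i)
        (coeff_linearPow_mem (hσn a han) (hσn c hcn) m i)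
    have hle := period_le_natDegree_mul_gcd hD hcoeff hroot
    have hdeg : D.natDegree ≤ m := (natDegree_sub_le _ _).trans
      (max_le (natDegree_linearPow_le _ _ _) (natDegree_linearPow_le _ _ _))
    obtain ⟨r, hr⟩ := Nat.gcd_dvd_left (period k t) n
    have hgpos : 0 < (period k t).gcd n := Nat.gcd_pos_of_pos_left _ (period_pos t)
    have hr' : period k t / (period k t).gcd n = r := Nat.div_eq_of_eq_mul_right hgpos hr
    have hrpos : 0 < r := by
      rcases Nat.eq_zero_or_pos r with rfl | h
      · have := period_pos (k := k) t
        omega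
      · exact h
    have hdvd : l ^ m ∣ r := by
      refine pow_dvd_right_of_pow_dvd_mul hl (g := (period k t).gcd n) (hr ▸ ht) ?_
      exact fun h => hn0 (h.trans (Nat.gcd_dvd_right _ _))
    have h1 := Nat.le_of_dvd hrpos hdvd
    -- The surplus m in the exponent e + m is there for this inequality: t is too large in degree to
    -- be a root of a nonzero polynomial of degree at most m.
    have h2 : m < l ^ m := Nat.lt_pow_self hl.one_lt
    omega
  obtain ⟨h1, h2⟩ := linearPow_injective hm ha hc key
  exact ⟨mem_periodicField.2 ((isPeriodicPt_frob_iff k).2 h1.symm),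
    mem_periodicField.2 ((isPeriodicPt_frob_iff k).2 h2.symm)⟩

end FiniteField

/-! ### Points of bounded degree in the fibres of a function -/

/-- A ring homomorphism to an algebraically closed field extends along an injective integral
extension. -/
theorem IsAlgClosed.exists_ringHom_comp_eq_of_isIntegral {W B L : Type*} [CommRing W] [CommRing B]
    [Algebra W B] [Algebra.IsIntegral W B] [FaithfulSMul W B] [Field L] [IsAlgClosed L]
    (ev : W →+* L) : ∃ θ : B →+* L, θ.comp (algebraMap W B) = ev := by
  have hP : (RingHom.ker ev).IsPrime := RingHom.ker_isPrime ev
  -- A prime Q over the kernel of `ev` turns the problem into lifting across an integral extension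
  -- of domains, where the target is algebraically closed.
  obtain ⟨Q, -, hQ, hQP⟩ := Ideal.exists_ideal_over_prime_of_isIntegral (RingHom.ker ev)
    (⊥ : Ideal B) (by
      rw [← RingHom.ker_eq_comap_bot,
        (RingHom.injective_iff_ker_eq_bot _).1 (FaithfulSMul.algebraMap_injective W B)]
      exact bot_le)
  let ev' : W ⧸ (RingHom.ker ev) →+* L := RingHom.kerLift ev
  let := ev'.toAlgebra
  have : Module.IsTorsionFree (W ⧸ RingHom.ker ev) L :=
    Module.isTorsionFree_iff_algebraMap_injective.2 (RingHom.kerLift_injective ev)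
  have : Q.LiesOver (RingHom.ker ev) := ⟨hQP.symm⟩
  have : Module.IsTorsionFree (W ⧸ RingHom.ker ev) (B ⧸ Q) :=
    Module.isTorsionFree_iff_algebraMap_injective.2 (FaithfulSMul.algebraMap_injective _ _)
  have : Algebra.IsIntegral (W ⧸ RingHom.ker ev) (B ⧸ Q) := inferInstance
  let θ : (B ⧸ Q) →ₐ[W ⧸ RingHom.ker ev] L := IsAlgClosed.lift
  refine ⟨θ.toRingHom.comp (Ideal.Quotient.mk Q), ?_⟩
  ext w
  have := θ.commutes (Ideal.Quotient.mk _ w)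
  exact this

namespace FiniteField

open Polynomial

/-- A nonzero finitely generated algebra over a domain `R` has a homomorphism, over `R`, to a field
that is algebraic over `R`, provided that `R` injects into it. -/
theorem _root_.Algebra.FiniteType.exists_algHom_isAlgebraic {R A : Type u} [CommRing R] [IsDomain R]
    [CommRing A] [IsDomain A] [Algebra R A] [FaithfulSMul R A] [Algebra.FiniteType R A] :
    ∃ (M : Type u) (_ : Field M) (_ : Algebra R M), Algebra.IsAlgebraic R M ∧ FaithfulSMul R M ∧
      Nonempty (A →ₐ[R] M) := by
  let F := FractionRing R
  let S := TensorProduct R F A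
  have : Nontrivial S := Algebra.TensorProduct.nontrivial_of_algebraMap_injective_of_isDomain R F A
    (FaithfulSMul.algebraMap_injective _ _) (FaithfulSMul.algebraMap_injective _ _)
  obtain ⟨N, hN⟩ := Ideal.exists_maximal S
  let M := S ⧸ N
  let : Field M := Ideal.Quotient.field N
  have : Algebra.FiniteType F M := .of_surjective (Ideal.Quotient.mkₐ F N)
    (Ideal.Quotient.mkₐ_surjective F N)
  -- Zariski's lemma on the generic fibre: its closed points have residue field finite over the
  -- fraction field of R.
  have hfin : Module.Finite F M := finite_of_finite_type_of_isJacobsonRing F M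
  refine ⟨M, inferInstance, inferInstance, ?_, ?_, ⟨(Ideal.Quotient.mkₐ R N).comp
    Algebra.TensorProduct.includeRight⟩⟩
  · exact (IsFractionRing.comap_isAlgebraic_iff (K := F)).2 (Algebra.IsAlgebraic.of_finite F M)
  · rw [faithfulSMul_iff_algebraMap_injective, IsScalarTower.algebraMap_eq R F M]
    exact (algebraMap F M).injective.comp (FaithfulSMul.algebraMap_injective R F)

/-- Let `G` be a transcendental element of a finitely generated domain `A` over a finite field.
Almost every `t` is the value of `G` at a point whose degree over `t` is bounded. -/
theorem exists_algHom_apply_eq {k L A : Type u} [Field k] [Finite k] [Field L] [Algebra k L]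
    [Algebra.IsAlgebraic k L] [IsAlgClosed L] [CommRing A] [IsDomain A] [Algebra k A]
    [Algebra.FiniteType k A] {G : A} (hG : Transcendental k G) :
    ∃ d : ℕ, 0 < d ∧ ∃ Z : Set L, Z.Finite ∧ ∀ t ∉ Z, ∃ φ : A →ₐ[k] L, φ G = t ∧
      ∀ n, t ∈ periodicField k L n → ∀ y, φ y ∈ periodicField k L (n * d) := by
  -- G is viewed as a dominant map to the affine line. A closed point of its generic fibre is a
  -- multisection; specialising it to X = t yields points of bounded degree over t.
  let : Algebra k[X] A := (aeval G).toAlgebra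
  have : IsScalarTower k k[X] A := .of_algebraMap_eq fun r => ((aeval G).commutes r).symm
  have : FaithfulSMul k[X] A :=
    (faithfulSMul_iff_algebraMap_injective _ _).2 (transcendental_iff_injective.1 hG)
  have : Algebra.FiniteType k[X] A := .of_restrictScalars_finiteType k _ _
  obtain ⟨M, _, _, hM1, hM2, ⟨π⟩⟩ := Algebra.FiniteType.exists_algHom_isAlgebraic (R := k[X]) (A := A)
  classical
  obtain ⟨s, hs⟩ := (inferInstance : Algebra.FiniteType k A)
  -- After inverting h the multisection becomes integral over W = k[X][1/h], so it can be
  -- specialised at every t with h(t) ≠ 0.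
  obtain ⟨h, hh0, hh⟩ := Algebra.IsAlgebraic.exists_integral_multiples k[X] (s.image π)
  let W := Localization.Away h
  have hu : IsUnit (algebraMap k[X] M h) := by
    rw [isUnit_iff_ne_zero, Ne, FaithfulSMul.algebraMap_eq_zero_iff]
    exact hh0
  let : Algebra W M := (IsLocalization.Away.lift h hu).toAlgebra
  have : IsScalarTower k[X] W M := .of_algebraMap_eq fun r =>
    (IsLocalization.Away.lift_eq h hu r).symm
  have hWM : Function.Injective (algebraMap W M) := by
    rw [injective_iff_map_eq_zero]
    intro w hw
    obtain ⟨r, i, rfl⟩ := IsLocalization.exists_mk'_eq (Submonoid.powers h) w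
    have h1 : algebraMap W M (algebraMap k[X] W r) = 0 := by
      rw [← IsLocalization.mk'_spec W r i, map_mul, hw, zero_mul]
    rw [← IsScalarTower.algebraMap_apply, FaithfulSMul.algebraMap_eq_zero_iff] at h1
    rw [h1, IsLocalization.mk'_zero]
  have hint : ∀ y ∈ s, IsIntegral W (π y) := by
    intro y hy
    have h1 : IsIntegral W (h • π y) := (hh (π y) (Finset.mem_image_of_mem _ hy)).tower_top
    have h2 : π y = (IsLocalization.Away.invSelf h : W) • (h • π y) := by
      rw [Algebra.smul_def, Algebra.smul_def, IsScalarTower.algebraMap_apply k[X] W M, ← mul_assoc,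
        ← map_mul, mul_comm (IsLocalization.Away.invSelf h), IsLocalization.Away.mul_invSelf,
        map_one, one_mul]
    rw [h2]
    exact h1.smul _
  have hint' := hint
  choose! p hpm hp0 using hint'
  -- Each generator y has monic equation `p y` over W, whose degree does not depend on t; the
  -- product of factorials accommodates all generators at once. The excluded values are the roots of
  -- h.
  refine ⟨∏ y ∈ s, ((p y).natDegree).factorial, Finset.prod_pos fun y _ => Nat.factorial_pos _,
    h.rootSet L, h.rootSet_finite L, fun t ht => ?_⟩
  have hht : aeval t h ≠ 0 := fun h0 => ht (by rw [mem_rootSet]; exact ⟨hh0, h0⟩)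
  let ev : W →+* L := IsLocalization.Away.lift h (g := (aeval t : k[X] →ₐ[k] L).toRingHom)
    (isUnit_iff_ne_zero.2 hht)
  have hev (r : k[X]) : ev (algebraMap k[X] W r) = aeval t r := IsLocalization.Away.lift_eq _ _ _
  have : FaithfulSMul W (integralClosure W M) := by
    rw [faithfulSMul_iff_algebraMap_injective]
    exact Function.Injective.of_comp (f := algebraMap (integralClosure W M) M) hWM
  obtain ⟨θ, hθ⟩ := IsAlgClosed.exists_ringHom_comp_eq_of_isIntegral (B := integralClosure W M) ev
  have hπ : ∀ y, IsIntegral W (π y) := by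
    intro y
    have hy : y ∈ Algebra.adjoin k (s : Set A) := hs ▸ Algebra.mem_top
    induction hy using Algebra.adjoin_induction with
    | mem x hx => exact hint x hx
    | algebraMap r =>
      rw [IsScalarTower.algebraMap_apply k k[X] A, AlgHom.commutes,
        IsScalarTower.algebraMap_apply k[X] W M]
      exact isIntegral_algebraMap
    | add x y _ _ hx hy => rw [map_add]; exact hx.add hy
    | mul x y _ _ hx hy => rw [map_mul]; exact hx.mul hy
  let φ₀ : A →+* integralClosure W M := π.toRingHom.codRestrict (integralClosure W M) hπ
  have hφ₀ (r : k[X]) : φ₀ (algebraMap k[X] A r) = algebraMap W _ (algebraMap k[X] W r) := by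
    apply Subtype.ext
    change π (algebraMap k[X] A r) = algebraMap W M (algebraMap k[X] W r)
    rw [AlgHom.commutes, IsScalarTower.algebraMap_apply k[X] W M]
  have hφ (r : k[X]) : θ (φ₀ (algebraMap k[X] A r)) = aeval t r := by
    rw [hφ₀, ← hev, ← hθ]; rfl
  let φ : A →ₐ[k] L := { θ.comp φ₀ with
    commutes' := fun r => by
      have := hφ (C r)
      rwa [aeval_C, ← Polynomial.algebraMap_eq, ← IsScalarTower.algebraMap_apply] at this }
  refine ⟨φ, ?_, ?_⟩
  · have := hφ X
    rw [aeval_X] at this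
    have hX : algebraMap k[X] A X = G := aeval_X G
    rwa [hX] at this
  · intro n hn
    have hgen : ∀ y ∈ s, φ y ∈ periodicField k L (n * ∏ y ∈ s, ((p y).natDegree).factorial) := by
      intro y hy
      have hcoeff : ∀ i, ((p y).map ev).coeff i ∈ periodicField k L n := by
        intro i
        rw [coeff_map]
        obtain ⟨r, j, hrj⟩ := IsLocalization.exists_mk'_eq (Submonoid.powers h) ((p y).coeff i)
        have haev (q : k[X]) : ev (algebraMap k[X] W q) ∈ periodicField k L n := by
          rw [hev]
          exact (IntermediateField.aeval_coe (periodicField k L n) (⟨t, hn⟩) q) ▸ SetLike.coe_mem _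
        have h1 : ev ((p y).coeff i) * ev (algebraMap k[X] W j) = ev (algebraMap k[X] W r) := by
          rw [← map_mul, ← hrj, IsLocalization.mk'_spec]
        have h2 : ev (algebraMap k[X] W j) ≠ 0 :=
          ((IsLocalization.map_units W j).map ev).ne_zero
        rw [eq_div_of_mul_eq h2 h1]
        exact div_mem (haev _) (haev _)
      have hroot : ((p y).map ev).IsRoot (φ y) := by
        have h1 : eval₂ (algebraMap W (integralClosure W M)) (φ₀ y) (p y) = 0 := by
          apply Subtype.val_injective
          have := hp0 y hy
          have h2 := hom_eval₂ (p y) (algebraMap W (integralClosure W M))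
            (algebraMap (integralClosure W M) M) (φ₀ y)
          exact h2.trans this
        have h3 := congrArg θ h1
        rw [hom_eval₂, hθ, map_zero] at h3
        rw [IsRoot, Polynomial.eval_map]
        exact h3
      have := mem_periodicField_mul_factorial ((hpm y hy).map ev).ne_zero hcoeff hroot
      rw [(hpm y hy).natDegree_map] at this
      exact periodicField_mono (mul_dvd_mul_left n (Finset.dvd_prod_of_mem _ hy)) this
    intro y
    have hy : y ∈ Algebra.adjoin k (s : Set A) := hs ▸ Algebra.mem_top
    have hle : Algebra.adjoin k (s : Set A) ≤ (periodicField k L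
        (n * ∏ y ∈ s, ((p y).natDegree).factorial)).toSubalgebra.comap φ :=
      Algebra.adjoin_le hgen
    exact hle hy

end FiniteField

/-! ### Pigeonhole over points of growing l-power degree -/

namespace FiniteField

open Polynomial

section

variable {k L A : Type u} [Field k] [Finite k] [Field L] [Algebra k L]
  [CommRing A] [Algebra k A]

/-- The degree of φ(y) divides n exactly when y^(q^n) - y lies in the kernel. Thus degrees do not
depend on the choice of residue field embedding. -/
theorem period_apply_eq_of_ker_eq {φ ψ : A →ₐ[k] L} (h : RingHom.ker φ = RingHom.ker ψ) (y : A) :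
    period k (φ y) = period k (ψ y) := by
  have key (n : ℕ) : period k (φ y) ∣ n ↔ period k (ψ y) ∣ n := by
    rw [← mem_periodicField_iff_dvd, ← mem_periodicField_iff_dvd, mem_periodicField,
      mem_periodicField, isPeriodicPt_frob_iff_pow, isPeriodicPt_frob_iff_pow, ← map_pow,
      ← map_pow, ← map_sub, ← map_sub]
    exact (SetLike.ext_iff.1 h) (y ^ (Nat.card k) ^ n - y)
  exact Nat.dvd_antisymm ((key _).2 dvd_rfl) ((key _).1 dvd_rfl)

theorem eq_of_infinite_setOf_eq_linearPow {a c a' c' : L} {m : ℕ} (hm : 0 < m) (ha : a ≠ 0)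
    (hc : c ≠ 0) {s : Set L} (hs : s.Infinite)
    (h : ∀ t ∈ s, a * (1 + c * t) ^ m = a' * (1 + c' * t) ^ m) : a = a' ∧ c = c' := by
  refine linearPow_injective hm ha hc (Polynomial.eq_of_infinite_eval_eq _ _ (hs.mono ?_))
  intro t ht
  simpa using h t ht

variable [Algebra.IsAlgebraic k L] [IsAlgClosed L] [IsDomain A] [Algebra.FiniteType k A]

theorem infinite_range_algHom_apply {G : A} (hG : Transcendental k G) :
    (Set.range fun φ : A →ₐ[k] L => φ G).Infinite := by
  obtain ⟨d, -, Z, hZ, H⟩ := exists_algHom_apply_eq (L := L) hG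
  have : Infinite L := IsAlgClosed.instInfinite
  refine (hZ.infinite_compl).mono fun t ht => ?_
  obtain ⟨φ, hφ, -⟩ := H t ht
  exact ⟨φ, hφ⟩

/-- If the relation `F = a (1 + c G) ^ m`, with `a, c` in a fixed proper subfield of an algebraic
closure `L` depending on the point, holds at almost all points of an affine variety over a finite
field, then some `a` and `c` work for infinitely many `L`-points. -/
theorem exists_infinite_setOf_algHom {F G : A} (hG : Transcendental k G)
    {K : IntermediateField k L} (hK : K ≠ ⊤) {T : Set L} (hTK : T ⊆ K) (hT0 : 0 ∉ T) {m : ℕ}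
    (hm : 0 < m) {bad : Set (Ideal A)} (hbad : bad.Finite)
    (H : ∀ φ : A →ₐ[k] L, RingHom.ker φ ∉ bad → ∃ ψ : A →ₐ[k] L, RingHom.ker ψ = RingHom.ker φ ∧
      ∃ a ∈ T, ∃ c ∈ T, ψ F = a * (1 + c * ψ G) ^ m) :
    ∃ a ∈ T, ∃ c ∈ T, {ψ : A →ₐ[k] L | ψ F = a * (1 + c * ψ G) ^ m}.Infinite := by
  obtain ⟨l, e, hl, hle⟩ := exists_prime_pow_not_dvd_period hK
  obtain ⟨d, hd, Z, hZ, hφ⟩ := exists_algHom_apply_eq (L := L) hG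
  choose t ht using fun j => exists_period_eq_prime_pow (k := k) (L := L) hl j
  have htinj : Function.Injective t := fun i j hij => by
    have := congrArg (period k) hij
    rw [ht, ht] at this
    have := Nat.pow_right_injective hl.two_le this
    omega
  obtain ⟨_, φ₀, -⟩ := (infinite_range_algHom_apply (L := L) hG).nonempty
  have : Nonempty (A →ₐ[k] L) := ⟨φ₀⟩
  choose! φ hφt hφd using hφ
  -- `t j` has degree l^(j+1), so the first condition says that l^(e+m) divides it.
  let J₀ : Set ℕ := {j | e + m ≤ j + 1 ∧ t j ∉ Z}
  have hJ₀ : J₀ᶜ.Finite := by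
    refine ((Set.finite_lt_nat (e + m)).union (hZ.preimage htinj.injOn)).subset ?_
    intro j hj
    by_cases h : e + m ≤ j + 1
    · exact Or.inr (by by_contra h'; exact hj ⟨h, h'⟩)
    · exact Or.inl (by simp only [Set.mem_ofPred_eq]; omega)
  -- The points over distinct `t j` are distinct since G has different degrees there; hence finitely
  -- many bad points exclude only finitely many j.
  have hkerinj : Set.InjOn (fun j => RingHom.ker (φ (t j))) J₀ := by
    intro i hi j hj hij
    have := period_apply_eq_of_ker_eq hij G
    rw [hφt _ hi.2, hφt _ hj.2, ht, ht] at this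
    have := Nat.pow_right_injective hl.two_le this
    omega
  let J : Set ℕ := {j ∈ J₀ | RingHom.ker (φ (t j)) ∉ bad}
  have hJ : J.Infinite := by
    have h1 : (J₀ ∩ (fun j => RingHom.ker (φ (t j))) ⁻¹' bad).Finite :=
      Set.Finite.of_injOn (f := fun j => RingHom.ker (φ (t j))) (fun j hj => hj.2) (hkerinj.mono Set.inter_subset_left) hbad
    have h2 : J = (J₀ᶜ ∪ (J₀ ∩ (fun j => RingHom.ker (φ (t j))) ⁻¹' bad))ᶜ := by
      ext j
      simp only [J, Set.mem_ofPred_eq, Set.mem_compl_iff, Set.mem_union, Set.mem_inter_iff,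
        Set.mem_preimage]
      tauto
    rw [h2]
    exact (hJ₀.union h1).infinite_compl
  -- The constants first fall into the field of degree l^(j+1)·d. As l^e does not divide their
  -- degrees, d·l^e already suffices, a bound free of j.
  have hex : ∀ j ∈ J, ∃ ψ : A →ₐ[k] L, period k (ψ G) = l ^ (j + 1) ∧
      ∃ a ∈ T ∩ periodicField k L (d * l ^ e), ∃ c ∈ T ∩ periodicField k L (d * l ^ e),
        ψ F = a * (1 + c * ψ G) ^ m := by
    intro j hj
    obtain ⟨ψ, hψ, a, ha, c, hc, hac⟩ := H _ hj.2
    have hper : period k (ψ G) = l ^ (j + 1) := by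
      rw [period_apply_eq_of_ker_eq hψ, hφt _ hj.1.2, ht]
    have hmem (y : A) : ψ y ∈ periodicField k L (l ^ (j + 1) * d) := by
      rw [mem_periodicField_iff_dvd, period_apply_eq_of_ker_eq hψ, ← mem_periodicField_iff_dvd]
      exact hφd _ hj.1.2 _ (mem_periodicField_iff_dvd.2 (ht j).dvd) y
    have h1 := mem_periodicField_of_eq_linearPow hl hm (fun h => hT0 (h ▸ ha))
      (fun h => hT0 (h ▸ hc)) (hle a (hTK ha)) (hle c (hTK hc))
      (hper ▸ pow_dvd_pow l hj.1.1) hac (hmem G) (hmem F)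
    have h2 {x : L} (hxT : x ∈ T) (hx : x ∈ periodicField k L (l ^ (j + 1) * d)) :
        x ∈ T ∩ periodicField k L (d * l ^ e) := by
      refine ⟨hxT, mem_periodicField_iff_dvd.2 ?_⟩
      refine dvd_mul_pow_of_not_pow_dvd hl (j := j + 1) ?_ (period_pos x).ne' (hle x (hTK hxT))
      rw [mul_comm]
      exact mem_periodicField_iff_dvd.1 hx
    exact ⟨ψ, hper, a, h2 ha h1.1, c, h2 hc h1.2, hac⟩
  choose! ψ hψ a ha c hc hac using hex
  have hfin : ((T ∩ periodicField k L (d * l ^ e)) ×ˢ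
      (T ∩ periodicField k L (d * l ^ e))).Finite := by
    have := (finite_periodicField (k := k) (L := L) (Nat.mul_pos hd (pow_pos hl.pos e))).subset
      (Set.inter_subset_right (s := T))
    exact this.prod this
  -- Pigeonhole: infinitely many j, finitely many pairs (a, c).
  obtain ⟨p, hp, hpinf⟩ : ∃ p ∈ (T ∩ periodicField k L (d * l ^ e)) ×ˢ
      (T ∩ (periodicField k L (d * l ^ e) : Set L)), (J ∩ {j | (a j, c j) = p}).Infinite := by
    by_contra! hcon
    refine hJ ((hfin.biUnion hcon).subset fun j hj => ?_)
    exact Set.mem_biUnion (x := (a j, c j)) ⟨ha j hj, hc j hj⟩ ⟨hj, rfl⟩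
  refine ⟨p.1, hp.1.1, p.2, hp.2.1, ?_⟩
  have hinj : Set.InjOn ψ (J ∩ {j | (a j, c j) = p}) := by
    intro i hi j hj hij
    have := congrArg (fun ψ : A →ₐ[k] L => period k (ψ G)) hij
    simp only [hψ i hi.1, hψ j hj.1] at this
    have := Nat.pow_right_injective hl.two_le this
    omega
  refine (hpinf.image hinj).mono ?_
  rintro _ ⟨j, ⟨hj, rfl⟩, rfl⟩
  exact hac j hj

end

end FiniteField

/-! ### Zeros of functions on smooth affine curves -/

theorem IsDedekindDomain.of_isPrincipal_maximalIdeal {B : Type*} [CommRing B] [IsDomain B]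
    [IsNoetherianRing B] (h : ∀ (q : Ideal B) [q.IsPrime],
      (IsLocalRing.maximalIdeal (Localization.AtPrime q)).IsPrincipal) : IsDedekindDomain B := by
  have : IsDedekindDomainDvr B :=
    { is_dvr_at_nonzero_prime := fun q hq hqp =>
        ((IsDiscreteValuationRing.TFAE (Localization.AtPrime q)
          (IsLocalization.AtPrime.not_isField B hq (Localization.AtPrime q))).out 4 0).mp (h q) }
  infer_instance

/-- A nonzero b has finitely many prime divisors, and each L-point where b vanishes gives one, its
kernel. An L-algebra map to L is determined by its kernel, since y - ψ(y) lies in it. -/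
theorem IsDedekindDomain.eq_zero_of_infinite_setOf_algHom {L B : Type*} [Field L] [CommRing B]
    [IsDedekindDomain B] [Algebra L B] {b : B} (h : {ψ : B →ₐ[L] L | ψ b = 0}.Infinite) :
    b = 0 := by
  by_contra hb
  have hfin := Ideal.finite_factors (I := Ideal.span {b}) (by simpa using hb)
  have hmem (ψ : {ψ : B →ₐ[L] L | ψ b = 0}) : b ∈ RingHom.ker ψ.1 := ψ.2
  have hp (ψ : B →ₐ[L] L) : (RingHom.ker ψ).IsPrime := RingHom.ker_isPrime _
  let F (ψ : {ψ : B →ₐ[L] L | ψ b = 0}) : HeightOneSpectrum B :=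
    ⟨RingHom.ker ψ.1, hp ψ.1, fun h0 => hb (by simpa [h0] using hmem ψ)⟩
  have hinj : Function.Injective F := by
    intro ψ ψ' hψ
    have h1 : RingHom.ker ψ.1 = RingHom.ker ψ'.1 := congrArg HeightOneSpectrum.asIdeal hψ
    apply Subtype.ext
    ext y
    have h2 : y - algebraMap L B (ψ.1 y) ∈ RingHom.ker ψ.1 := by
      rw [RingHom.mem_ker, map_sub, AlgHom.commutes]; simp
    rw [h1, RingHom.mem_ker, map_sub, AlgHom.commutes, sub_eq_zero] at h2
    simpa using h2.symm
  have : Infinite {ψ : B →ₐ[L] L | ψ b = 0} := h.to_subtype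
  refine (Set.infinite_range_of_injective hinj) (hfin.subset ?_)
  rintro _ ⟨ψ, rfl⟩
  rw [Set.mem_ofPred_eq, Ideal.dvd_span_singleton]
  exact hmem ψ

/-! ### Constants and geometric fibres -/

namespace CurvesOverFiniteFields

section Constants

variable {k : Type u} [Field k] {X : Scheme.{u}} (s : X ⟶ Spec (.of k))

theorem map_const {U V : X.Opens} (i : V ≤ U) (r : k) :
    X.presheaf.map (homOfLE i).op (const s U r) = const s V r :=
  congr($(s.appLE_map (U := ⊤) (V := U) (show U ≤ s ⁻¹ᵁ ⊤ from le_top) (homOfLE i).op).hom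
    ((Scheme.ΓSpecIso (.of k)).inv r))

theorem appLE_const {Y : Scheme.{u}} (t : Y ⟶ Spec (.of k)) (f : X ⟶ Y) (h : f ≫ t = s)
    (U : Y.Opens) (V : X.Opens) (e : V ≤ f ⁻¹ᵁ U) (r : k) :
    f.appLE U V e (const t U r) = const s V r := by
  subst h
  exact congr($(Scheme.Hom.appLE_comp_appLE f t ⊤ U V (show U ≤ t ⁻¹ᵁ ⊤ from le_top) e).hom
    ((Scheme.ΓSpecIso (.of k)).inv r))

theorem const_comp_specMap {k' : Type u} [Field k'] (φ : k →+* k') (t : X ⟶ Spec (.of k'))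
    (h : t ≫ Spec.map (CommRingCat.ofHom φ) = s) (U : X.Opens) (r : k) :
    const s U r = const t U (φ r) := by
  subst h
  have h1 := congr($(Scheme.Hom.appLE_comp_appLE t (Spec.map (CommRingCat.ofHom φ)) ⊤ ⊤ U
    le_top (show U ≤ t ⁻¹ᵁ ⊤ from le_top)).hom ((Scheme.ΓSpecIso (.of k)).inv r))
  have h2 := congr($(Scheme.ΓSpecIso_inv_naturality (CommRingCat.ofHom φ)).hom r)
  have h3 : (Spec.map (CommRingCat.ofHom φ)).appLE ⊤ ⊤ le_top =
      (Spec.map (CommRingCat.ofHom φ)).appTop := Scheme.Hom.appLE_eq_app _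
  rw [h3] at h1
  exact h1.symm.trans (congrArg (t.appLE ⊤ U (show U ≤ t ⁻¹ᵁ ⊤ from le_top)).hom h2.symm)

variable (kbar : Type u) [Field kbar] [Algebra k kbar]

theorem geomFibre.condition : geomFibre.toSpec s kbar ≫
    Spec.map (CommRingCat.ofHom (algebraMap k kbar)) = geomFibre.proj s kbar ≫ s :=
  pullback.condition.symm

theorem geomFibre.app_const (U : X.Opens) (r : k) :
    (geomFibre.proj s kbar).app U (const s U r) =
      const (geomFibre.toSpec s kbar) (geomFibre.proj s kbar ⁻¹ᵁ U) (algebraMap k kbar r) := by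
  have h1 := appLE_const (geomFibre.proj s kbar ≫ s) s (geomFibre.proj s kbar) rfl U
    (geomFibre.proj s kbar ⁻¹ᵁ U) le_rfl r
  rw [Scheme.Hom.appLE_eq_app] at h1
  rw [h1]
  exact const_comp_specMap _ _ _ (geomFibre.condition s kbar) _ r

end Constants

theorem map_mem_primaryPart {G H : Type*} [CommGroup G] [CommGroup H] {T : Set Nat.Primes}
    (φ : G →* H) {a : G} (ha : a ∈ primaryPart T G) : φ a ∈ primaryPart T H :=
  ⟨φ.isOfFinOrder ha.1, fun ℓ h => ha.2 ℓ (h.trans (orderOf_map_dvd φ a))⟩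

theorem PropP.propPbar {k : Type u} [Field k] {X : Scheme.{u}} {f g : X ⟶ P1 k}
    {s : X ⟶ Spec (.of k)} (kbar : Type u) [Field kbar] [Algebra k kbar] {S : Set Nat.Primes}
    {m : ℕ} (h : PropP f g s S m) : PropPbar f g s kbar S m := by
  obtain ⟨a, ha, c, hc, h⟩ := h
  refine ⟨_, map_mem_primaryPart (Units.map (algebraMap k kbar).toMonoidHom) ha, _,
    map_mem_primaryPart (Units.map (algebraMap k kbar).toMonoidHom) hc, ?_⟩
  rw [h, map_mul, map_pow, map_add, map_mul, map_one, geomFibre.app_const, geomFibre.app_const]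
  rfl

end CurvesOverFiniteFields

/-! ### Residue fields of closed points -/

namespace CurvesOverFiniteFields

variable {k : Type u} [Field k] {X : Scheme.{u}} (s : X ⟶ Spec (.of k))

theorem evaluation_map {U V : X.Opens} (i : V ≤ U) (x : X) (hx : x ∈ V) (b : Γ(X, U)) :
    X.evaluation V x hx (X.presheaf.map (homOfLE i).op b) = X.evaluation U x (i hx) b :=
  congr(X.residue x ($(X.presheaf.germ_res (homOfLE i) x hx).hom b))

theorem toResidue_congr (U V : X.Opens) (x : X) (hxU : x ∈ U) (hxV : x ∈ V) :
    toResidue s U x hxU = toResidue s V x hxV := by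
  have (W W' : X.Opens) (h : W' ≤ W) (hx : x ∈ W') (hx' : x ∈ W) :
      toResidue s W x hx' = toResidue s W' x hx := by
    ext r
    simp only [toResidue, RingHom.comp_apply]
    rw [← map_const s h r]
    exact (evaluation_map h x hx _).symm
  rw [this U (U ⊓ V) inf_le_left ⟨hxU, hxV⟩, this V (U ⊓ V) inf_le_right ⟨hxU, hxV⟩]

theorem toResidue_top (x : X) : CommRingCat.ofHom (toResidue s ⊤ x trivial) =
    (Scheme.ΓSpecIso (.of k)).inv ≫ (Spec (.of k)).Γevaluation (s x) ≫ s.residueFieldMap x := by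
  have h : s.appLE ⊤ ⊤ le_top = s.appTop := Scheme.Hom.appLE_eq_app _
  rw [Scheme.Γevaluation_naturality, ← h]
  rfl

theorem specMap_toResidue (x : X) : Spec.map (CommRingCat.ofHom (toResidue s ⊤ x trivial)) =
    X.fromSpecResidueField x ≫ s := by
  rw [toResidue_top, ← Scheme.Hom.SpecMap_residueFieldMap_fromSpecResidueField,
    ← Scheme.Spec.map_residueFieldIso_inv_eq_fromSpecResidueField, ← Spec.map_comp,
    ← Spec.map_comp]
  exact congr(Spec.map ($((Scheme.Spec.algebraMap_residueFieldIso_inv (.of k) (s x)).symm) ≫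
    s.residueFieldMap x))

/-- The residue field at a closed point is finite over the ground field. -/
theorem finite_toResidue [LocallyOfFiniteType s] {U : X.Opens} {x : X} (hx : x ∈ U)
    (hcl : IsClosed {x}) : (toResidue s U x hx).Finite := by
  rw [toResidue_congr s U ⊤ x hx trivial]
  have : JacobsonSpace X := LocallyOfFiniteType.jacobsonSpace s
  have : LocallyOfFiniteType (X.fromSpecResidueField x) :=
    isClosed_singleton_iff_locallyOfFiniteType.1 hcl
  have h : LocallyOfFiniteType (Spec.map (CommRingCat.ofHom (toResidue s ⊤ x trivial))) := by
    rw [specMap_toResidue]; infer_instance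
  have h : (toResidue s ⊤ x trivial).FiniteType :=
    (HasRingHomProperty.Spec_iff (P := @LocallyOfFiniteType)).1 h
  algebraize [toResidue s ⊤ x trivial]
  exact finite_of_finite_type_of_isJacobsonRing k (X.residueField x)

theorem exists_ringHom_residueField [LocallyOfFiniteType s] (kbar : Type u) [Field kbar]
    [Algebra k kbar] [IsAlgClosed kbar] {U : X.Opens} {x : X} (hx : x ∈ U) (hcl : IsClosed {x}) :
    ∃ ι : X.residueField x →+* kbar, ι.comp (toResidue s U x hx) = algebraMap k kbar := by
  have h := finite_toResidue s hx hcl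
  algebraize [toResidue s U x hx]
  exact ⟨(IsAlgClosed.lift : X.residueField x →ₐ[k] kbar).toRingHom, AlgHom.comp_algebraMap _⟩

/-- No point is exceptional: the global constants work everywhere, and closedness of x is used only
to embed its residue field. -/
theorem PropP.propQbar {f g : X ⟶ P1 k} [LocallyOfFiniteType s] {kbar : Type u} [Field kbar]
    [Algebra k kbar] [IsAlgClosed kbar] {S : Set Nat.Primes} {m : ℕ} (h : PropP f g s S m) :
    PropQbar f g s kbar S m := by
  obtain ⟨a, ha, c, hc, h⟩ := h
  refine Set.finite_empty.subset fun x ⟨hcl, hx, hrel⟩ => hrel ?_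
  obtain ⟨ι, hι⟩ := exists_ringHom_residueField s kbar hx hcl
  have hι' (r : k) : ι (X.evaluation _ x hx (const s _ r)) = algebraMap k kbar r :=
    congr($hι r)
  refine ⟨ι, hι, _, map_mem_primaryPart (Units.map (algebraMap k kbar).toMonoidHom) ha, _,
    map_mem_primaryPart (Units.map (algebraMap k kbar).toMonoidHom) hc, ?_⟩
  rw [h]
  simp only [map_mul, map_pow, map_add, map_one, hι']
  rfl

/-! ### Closed points of affine open subschemes -/

theorem ker_evaluation {V : X.Opens} (hV : IsAffineOpen V) (x : X) (hx : x ∈ V) :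
    RingHom.ker (X.evaluation V x hx).hom = (hV.primeIdealOf ⟨x, hx⟩).asIdeal := by
  ext b
  rw [RingHom.mem_ker]
  have h1 : (X.evaluation V x hx).hom b = 0 ↔ x ∉ X.basicOpen b :=
    X.evaluation_eq_zero_iff_notMem_basicOpen x hx b
  have h2 : hV.fromSpec (hV.primeIdealOf ⟨x, hx⟩) ∈ X.basicOpen b ↔
      hV.primeIdealOf ⟨x, hx⟩ ∈ PrimeSpectrum.basicOpen b := by
    rw [← hV.fromSpec_preimage_basicOpen]; rfl
  rw [h1, ← not_iff_not, not_not, ← PrimeSpectrum.mem_basicOpen, ← h2, hV.fromSpec_primeIdealOf]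

/-- In a Jacobson scheme a point closed in an open subscheme is closed in the whole. -/
theorem isClosed_singleton_fromSpec [JacobsonSpace X] {V : X.Opens} (hV : IsAffineOpen V)
    (p : Spec Γ(X, V)) (hp : p.asIdeal.IsMaximal) : IsClosed {hV.fromSpec p} :=
  Scheme.Hom.closePoints_subset_preimage_closedPoints hV.fromSpec
    ((PrimeSpectrum.isClosed_singleton_iff_isMaximal p).2 hp)

end CurvesOverFiniteFields

/-! ### Affine open subschemes and their geometric points -/

namespace CurvesOverFiniteFields

variable {k : Type u} [Field k] {X : Scheme.{u}} (s : X ⟶ Spec (.of k))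

theorem finiteType_const [LocallyOfFiniteType s] {V : X.Opens} (hV : IsAffineOpen V) :
    (const s V).FiniteType := by
  have h := s.finiteType_appLE (isAffineOpen_top _) hV le_top
  exact h.comp (RingHom.FiniteType.of_surjective _
    (ConcreteCategory.bijective_of_isIso (Scheme.ΓSpecIso (.of k)).inv).2)

theorem fromSpec_comp {V : X.Opens} (hV : IsAffineOpen V) :
    hV.fromSpec ≫ s = Spec.map (CommRingCat.ofHom (const s V)) := by
  rw [← (isAffineOpen_top _).SpecMap_appLE_fromSpec s hV le_top, IsAffineOpen.fromSpec_top,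
    Scheme.isoSpec_Spec_inv, ← Spec.map_comp]
  rfl

theorem fromSpec_appLE {V : X.Opens} (hV : IsAffineOpen V) :
    hV.fromSpec.appLE V ⊤ hV.fromSpec_preimage_self.ge = (Scheme.ΓSpecIso _).inv := by
  rw [Scheme.Hom.appLE, hV.fromSpec_app_self, Category.assoc, ← Functor.map_comp]
  exact (congrArg _ ((Spec Γ(X, V)).presheaf.map_id _)).trans (Category.comp_id _)

theorem specMap_fromSpec_appLE {V : X.Opens} (hV : IsAffineOpen V) {L : CommRingCat.{u}}
    (ψ : Γ(X, V) ⟶ L) (e : ⊤ ≤ (Spec.map ψ ≫ hV.fromSpec) ⁻¹ᵁ V) :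
    (Spec.map ψ ≫ hV.fromSpec).appLE V ⊤ e ≫ (Scheme.ΓSpecIso L).hom = ψ := by
  have h : (Spec.map ψ).appLE ⊤ ⊤ le_top = (Spec.map ψ).appTop := Scheme.Hom.appLE_eq_app _
  rw [← Scheme.Hom.appLE_comp_appLE (Spec.map ψ) hV.fromSpec V ⊤ ⊤
    (hV.fromSpec_preimage_self.ge) le_top, fromSpec_appLE hV, h,
    Category.assoc, Scheme.ΓSpecIso_naturality, Iso.inv_hom_id_assoc]

variable (kbar : Type u) [Field kbar] [Algebra k kbar]

/-- A kbar-point of V over k and the identity of Spec kbar define a kbar-rational point of the fibre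
product; Ψ is evaluation there. -/
theorem geomFibre.exists_ringHom {V : X.Opens} (hV : IsAffineOpen V) (ψ : Γ(X, V) →+* kbar)
    (hψ : ψ.comp (const s V) = algebraMap k kbar) :
    ∃ Ψ : Γ(geomFibre s kbar, geomFibre.proj s kbar ⁻¹ᵁ V) →+* kbar,
      (∀ r, Ψ (const (geomFibre.toSpec s kbar) _ r) = r) ∧
        ∀ b, Ψ ((geomFibre.proj s kbar).app V b) = ψ b := by
  have w : (Spec.map (CommRingCat.ofHom ψ) ≫ hV.fromSpec) ≫ s =
      𝟙 (Spec (.of kbar)) ≫ Spec.map (CommRingCat.ofHom (algebraMap k kbar)) := by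
    rw [Category.assoc, fromSpec_comp, ← Spec.map_comp, Category.id_comp, ← hψ]
    rfl
  let p : Spec (.of kbar) ⟶ geomFibre s kbar := pullback.lift _ _ w
  have h1 : p ≫ geomFibre.proj s kbar = Spec.map (CommRingCat.ofHom ψ) ≫ hV.fromSpec :=
    pullback.lift_fst _ _ w
  have h2 : p ≫ geomFibre.toSpec s kbar = 𝟙 _ := pullback.lift_snd _ _ w
  have e : ⊤ ≤ (Spec.map (CommRingCat.ofHom ψ) ≫ hV.fromSpec) ⁻¹ᵁ V := by
    rw [Scheme.Hom.comp_preimage, hV.fromSpec_preimage_self]; rfl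
  have e' : ⊤ ≤ p ⁻¹ᵁ (geomFibre.proj s kbar ⁻¹ᵁ V) := by
    rw [← Scheme.Hom.comp_preimage, h1]; exact e
  refine ⟨(p.appLE (geomFibre.proj s kbar ⁻¹ᵁ V) ⊤ e' ≫ (Scheme.ΓSpecIso (.of kbar)).hom).hom,
    fun r => ?_, fun b => ?_⟩
  · have := appLE_const (𝟙 _) (geomFibre.toSpec s kbar) p h2 _ _ e' r
    refine (congrArg (Scheme.ΓSpecIso (.of kbar)).hom this).trans ?_
    have h3 : (𝟙 (Spec (.of kbar)) : _ ⟶ _).appLE ⊤ ⊤ le_top = 𝟙 _ :=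
      Scheme.Hom.appLE_eq_app _
    exact (congr((Scheme.ΓSpecIso (.of kbar)).hom ($h3 ((Scheme.ΓSpecIso (.of kbar)).inv r)))).trans
      congr($((Scheme.ΓSpecIso (.of kbar)).inv_hom_id).hom r)
  · have h3 := specMap_fromSpec_appLE hV (CommRingCat.ofHom ψ) e
    have h4 := Scheme.Hom.appLE_comp_appLE p (geomFibre.proj s kbar) V
      (geomFibre.proj s kbar ⁻¹ᵁ V) ⊤ le_rfl e'
    rw [Scheme.Hom.appLE_eq_app] at h4
    simp only [← h1] at h3
    rw [← h4, Category.assoc] at h3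
    exact congr($h3 b)

end CurvesOverFiniteFields

/-! ### Geometric fibres of smooth curves -/

namespace CurvesOverFiniteFields

variable {k : Type u} [Field k] {X : Scheme.{u}} (s : X ⟶ Spec (.of k))
  (kbar : Type u) [Field kbar] [Algebra k kbar]

theorem geomFibre.isPullback : IsPullback (geomFibre.proj s kbar) (geomFibre.toSpec s kbar) s
    (Spec.map (CommRingCat.ofHom (algebraMap k kbar))) :=
  IsPullback.of_hasPullback _ _

instance [SmoothOfRelativeDimension 1 s] :
    SmoothOfRelativeDimension 1 (geomFibre.toSpec s kbar) :=
  have := smoothOfRelativeDimension_isStableUnderBaseChange.{u} 1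
  MorphismProperty.IsStableUnderBaseChange.of_isPullback
    (geomFibre.isPullback s kbar) inferInstance

instance [GeometricallyConnected s] : ConnectedSpace (geomFibre s kbar) :=
  have : GeometricallyConnected (geomFibre.toSpec s kbar) :=
    inferInstanceAs (GeometricallyConnected (pullback.snd s _))
  have : Subsingleton (Spec (.of kbar)) := inferInstanceAs (Subsingleton (PrimeSpectrum kbar))
  have : Nonempty (Spec (.of kbar)) := inferInstanceAs (Nonempty (PrimeSpectrum kbar))
  GeometricallyConnected.connectedSpace_of_subsingleton (geomFibre.toSpec s kbar)

instance [SmoothOfRelativeDimension 1 s] [GeometricallyConnected s] :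
    IsIntegral (geomFibre s kbar) :=
  SmoothOfRelativeDimension.isIntegral (geomFibre.toSpec s kbar)

instance : IsAffineHom (geomFibre.proj s kbar) :=
  MorphismProperty.IsStableUnderBaseChange.of_isPullback
    (geomFibre.isPullback s kbar).flip inferInstance

theorem isDedekindDomain_section {Y : Scheme.{u}} (t : Y ⟶ Spec (.of k))
    [SmoothOfRelativeDimension 1 t] [IsIntegral Y] {W : Y.Opens} (hW : IsAffineOpen W)
    [Nonempty W] : IsDedekindDomain Γ(Y, W) := by
  have : Smooth t := SmoothOfRelativeDimension.smooth 1 t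
  have : IsLocallyNoetherian Y := LocallyOfFiniteType.isLocallyNoetherian t
  have : IsNoetherianRing Γ(Y, W) := IsLocallyNoetherian.component_noetherian ⟨W, hW⟩
  refine IsDedekindDomain.of_isPrincipal_maximalIdeal fun q hq => ?_
  let p : Spec Γ(Y, W) := ⟨q, hq⟩
  have hy : hW.fromSpec p ∈ W := by
    have : hW.fromSpec p ∈ Set.range hW.fromSpec := ⟨p, rfl⟩
    rwa [hW.range_fromSpec] at this
  let := Y.presheaf.algebra_section_stalk (⟨_, hy⟩ : W)
  have : IsLocalization q.primeCompl (Y.presheaf.stalk (hW.fromSpec p)) :=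
    hW.isLocalization_stalk' p hy
  exact IsLocalRing.isPrincipal_maximalIdeal_of_ringEquiv
    (IsLocalization.algEquiv q.primeCompl (Y.presheaf.stalk (hW.fromSpec p))
      (Localization.AtPrime q)).toRingEquiv
    (SmoothOfRelativeDimension.isDomain_and_isPrincipal_stalk t _).2

theorem geomFibre.map_app {U V : X.Opens} (i : V ≤ U) (b : Γ(X, U)) :
    (geomFibre s kbar).presheaf.map
      (homOfLE fun _ hx => i hx : geomFibre.proj s kbar ⁻¹ᵁ V ⟶ geomFibre.proj s kbar ⁻¹ᵁ U).op
        ((geomFibre.proj s kbar).app U b) =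
      (geomFibre.proj s kbar).app V (X.presheaf.map (homOfLE i).op b) :=
  congr($(((geomFibre.proj s kbar).naturality (homOfLE i).op).symm) b)

variable [SmoothOfRelativeDimension 1 s] [GeometricallyConnected s]

/-- Each ψ lifts to a kbar-point of the geometric fibre at which the difference of the two sides
vanishes, and the sections there form a Dedekind domain. -/
theorem geomFibre.eq_of_infinite {V : X.Opens} (hV : IsAffineOpen V)
    (F G : Γ(X, V)) (a c : kbar) (m : ℕ)
    (h : {ψ : Γ(X, V) →+* kbar | ψ.comp (const s V) = algebraMap k kbar ∧
      ψ F = a * (1 + c * ψ G) ^ m}.Infinite) :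
    (geomFibre.proj s kbar).app V F = const (geomFibre.toSpec s kbar) _ a *
      (1 + const (geomFibre.toSpec s kbar) _ c * (geomFibre.proj s kbar).app V G) ^ m := by
  have hW : IsAffineOpen (geomFibre.proj s kbar ⁻¹ᵁ V) := hV.preimage _
  let := (const (geomFibre.toSpec s kbar) (geomFibre.proj s kbar ⁻¹ᵁ V)).toAlgebra
  obtain ⟨ψ₀, hψ₀, -⟩ := h.nonempty
  have hne := (geomFibre.exists_ringHom s kbar hV ψ₀ hψ₀).nonempty
  have : Nontrivial Γ(geomFibre s kbar, geomFibre.proj s kbar ⁻¹ᵁ V) :=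
    hne.some.domain_nontrivial
  choose! Ψ hΨ using fun ψ : Γ(X, V) →+* kbar => geomFibre.exists_ringHom s kbar hV ψ
  have : Nonempty (geomFibre.proj s kbar ⁻¹ᵁ V) := by
    by_contra h0
    have h1 : geomFibre.proj s kbar ⁻¹ᵁ V = ⊥ := by
      ext y
      simpa using fun hy => h0 ⟨y, hy⟩
    rw [h1] at this
    exact not_subsingleton _ (inferInstance : Subsingleton Γ(geomFibre s kbar, ⊥))
  have := isDedekindDomain_section (geomFibre.toSpec s kbar) hW
  rw [← sub_eq_zero]
  refine IsDedekindDomain.eq_zero_of_infinite_setOf_algHom (L := kbar) fun hfin => h ?_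
  -- Restricting zeros Φ along the projection reaches every ψ in the set, so finitely many Φ would
  -- leave finitely many ψ.
  refine (hfin.image fun Φ => (AlgHom.toRingHom Φ).comp ((geomFibre.proj s kbar).app V).hom).subset ?_
  rintro ψ ⟨hψ, hψF⟩
  refine ⟨⟨Ψ ψ, (hΨ ψ hψ).1⟩, ?_, RingHom.ext (hΨ ψ hψ).2⟩
  change Ψ ψ _ = 0
  rw [map_sub, map_mul, map_pow, map_add, map_mul, map_one, (hΨ ψ hψ).1, (hΨ ψ hψ).1,
    (hΨ ψ hψ).2, (hΨ ψ hψ).2, hψF, sub_self]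

/-- A relation between functions on `U` that holds on a nonempty open subscheme `V` holds on
`U`. -/
theorem geomFibre.eq_of_eq_map {U V : X.Opens} (i : V ≤ U) (hV : Nonempty V)
    {F G : Γ(X, U)} {a c : kbar} {m : ℕ}
    (h : (geomFibre.proj s kbar).app V (X.presheaf.map (homOfLE i).op F) =
      const (geomFibre.toSpec s kbar) _ a * (1 + const (geomFibre.toSpec s kbar) _ c *
        (geomFibre.proj s kbar).app V (X.presheaf.map (homOfLE i).op G)) ^ m) :
    (geomFibre.proj s kbar).app U F = const (geomFibre.toSpec s kbar) _ a *
      (1 + const (geomFibre.toSpec s kbar) _ c * (geomFibre.proj s kbar).app U G) ^ m := by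
  have : Surjective (geomFibre.proj s kbar) := inferInstanceAs (Surjective (pullback.fst s _))
  have : Nonempty (geomFibre.proj s kbar ⁻¹ᵁ V) := by
    obtain ⟨x, hx⟩ := hV
    obtain ⟨y, rfl⟩ := (geomFibre.proj s kbar).surjective x
    exact ⟨y, hx⟩
  apply map_injective_of_isIntegral _
    (homOfLE fun _ hx => i hx : geomFibre.proj s kbar ⁻¹ᵁ V ⟶ geomFibre.proj s kbar ⁻¹ᵁ U)
  simp only [map_mul, map_pow, map_add, map_one, geomFibre.map_app]
  rw [h]
  congr 1
  · exact (map_const _ _ _).symm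
  · congr 3
    exact (map_const _ _ _).symm

end CurvesOverFiniteFields

/-! ### The projective line -/

/-- Homogeneous forms of degree `n` satisfy `F(u y) = u ^ n F(y)`. -/
theorem MvPolynomial.IsHomogeneous.eval₂_smul {σ R S : Type*} [CommSemiring R] [CommSemiring S]
    (φ : R →+* S) {F : MvPolynomial σ R} {n : ℕ} (hF : F.IsHomogeneous n) (u : S) (y : σ → S) :
    F.eval₂ φ (fun i => u * y i) = u ^ n * F.eval₂ φ y := by
  rw [MvPolynomial.eval₂_eq, MvPolynomial.eval₂_eq, Finset.mul_sum]
  refine Finset.sum_congr rfl fun d hd => ?_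
  have h := hF (MvPolynomial.mem_support_iff.1 hd)
  simp only [mul_pow, Finset.prod_mul_distrib, Finset.prod_pow_eq_pow_sum]
  have h' : ∑ i ∈ d.support, d i = n := by
    rw [← h, Finsupp.weight_apply, Finsupp.sum]; simp
  rw [h']
  ring

theorem AlgebraicGeometry.Proj.fromSpec_basicOpen {σ A : Type*} [CommRing A] [SetLike σ A]
    [AddSubgroupClass σ A] (𝒜 : ℕ → σ) [GradedRing 𝒜] {f : A} {m : ℕ} (hf : f ∈ 𝒜 m)
    (hm : 0 < m) : (Proj.isAffineOpen_basicOpen 𝒜 f hf hm).fromSpec =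
      Spec.map (Proj.awayToSection 𝒜 f) ≫ Proj.awayι 𝒜 f hf hm := by
  have h : (Proj.basicOpenIsoSpec 𝒜 f hf hm).hom = Proj.basicOpenToSpec 𝒜 f :=
    Proj.basicOpenIsoSpec_hom 𝒜 f hf hm
  rw [← cancel_epi (Proj.isAffineOpen_basicOpen 𝒜 f hf hm).isoSpec.hom,
    IsAffineOpen.isoSpec_hom_fromSpec, IsAffineOpen.isoSpec_hom, ← Category.assoc]
  rw [Proj.basicOpenToSpec] at h
  rw [← h, Proj.awayι, Iso.hom_inv_id_assoc]

theorem Localization.isUnit_algebraMap_powers {A : Type*} [CommRing A] (f : A) :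
    IsUnit (algebraMap A (Localization (Submonoid.powers f)) f) :=
  IsLocalization.map_units _ (⟨f, Submonoid.mem_powers f⟩ : Submonoid.powers f)

theorem HomogeneousLocalization.Away.pow_mul_val_mk {σ A : Type*} [CommRing A] [SetLike σ A]
    [AddSubgroupClass σ A] (𝒜 : ℕ → σ) [GradedRing 𝒜] {f : A} {d : ℕ} (hf : f ∈ 𝒜 d) (n : ℕ)
    (x : A) (hx : x ∈ 𝒜 (n • d)) :
    algebraMap A (Localization (Submonoid.powers f)) f ^ n *
      (HomogeneousLocalization.Away.mk 𝒜 hf n x hx).val = algebraMap A _ x := by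
  rw [Away.val_mk, Localization.mk_eq_mk', ← map_pow]
  exact IsLocalization.mk'_spec' _ x (⟨f ^ n, _⟩ : Submonoid.powers f)

namespace CurvesOverFiniteFields

open HomogeneousLocalization

variable (k : Type u) [Field k]

theorem X_mem_grading (i : Fin 2) : MvPolynomial.X i ∈ grading k 1 :=
  MvPolynomial.isHomogeneous_X k i

theorem P1.isAffineOpen_finitePart : IsAffineOpen (P1.finitePart k) :=
  Proj.isAffineOpen_basicOpen (grading k) _ (X_mem_grading k 1) one_pos

theorem P1.fromSpec_finitePart_comp : (P1.isAffineOpen_finitePart k).fromSpec ≫ P1.toSpec k =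
    Spec.map (CommRingCat.ofHom (algebraMap k (grading k 0)) ≫
      CommRingCat.ofHom (fromZeroRingHom (grading k) _) ≫
        Proj.awayToSection (grading k) (MvPolynomial.X 1)) := by
  refine (congrArg (· ≫ P1.toSpec k)
    (Proj.fromSpec_basicOpen (grading k) (X_mem_grading k 1) one_pos)).trans ?_
  rw [Spec.map_comp, Spec.map_comp, ← Proj.awayι_toSpecZero _ _ (X_mem_grading k 1) one_pos]
  simp only [P1.toSpec, Category.assoc]
  rfl

theorem P1.const_finitePart (r : k) : const (P1.toSpec k) (P1.finitePart k) r =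
    Proj.awayToSection (grading k) (MvPolynomial.X 1)
      (fromZeroRingHom (grading k) _ (algebraMap k (grading k 0) r)) := by
  have h := fromSpec_comp (P1.toSpec k) (P1.isAffineOpen_finitePart k)
  rw [P1.fromSpec_finitePart_comp] at h
  exact congr($(Spec.map_injective h.symm) r)

/-- Homogeneity of degree n gives F / X₁^n = F(X₀/X₁, 1), so functions on the affine line are
polynomials in the coordinate. -/
theorem away_eq_eval₂ (z : Away (grading k) (MvPolynomial.X 1)) :
    ∃ F : MvPolynomial (Fin 2) k, z = F.eval₂
      ((fromZeroRingHom (grading k) _).comp (algebraMap k (grading k 0)))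
      ![Away.mk (grading k) (d := 1) (f := MvPolynomial.X 1)
      (MvPolynomial.isHomogeneous_X k 1) 1 (MvPolynomial.X 0)
      (MvPolynomial.isHomogeneous_X k 0), 1] := by
  obtain ⟨n, F, hF, rfl⟩ := Away.mk_surjective (grading k) (X_mem_grading k 1) z
  refine ⟨F, val_injective _ ?_⟩
  have hF' : F.IsHomogeneous n := by
    have : F ∈ grading k (n • 1) := hF
    rwa [smul_eq_mul, mul_one] at this
  have h1 := Away.pow_mul_val_mk (grading k) (X_mem_grading k 1) n F hF
  have h3 := Away.pow_mul_val_mk (grading k) (X_mem_grading k 1) 1 _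
    (MvPolynomial.isHomogeneous_X k 0)
  have hu := Localization.isUnit_algebraMap_powers (MvPolynomial.X 1 : MvPolynomial (Fin 2) k)
  refine (hu.pow n).mul_left_cancel (h1.trans ?_)
  rw [← HomogeneousLocalization.algebraMap_apply, MvPolynomial.eval₂_comp_left, ← hF'.eval₂_smul]
  have h2 : F = F.eval₂ MvPolynomial.C MvPolynomial.X := (MvPolynomial.eval₂_eta F).symm
  conv_lhs => rw [h2, MvPolynomial.eval₂_comp_left]
  congr 1
  ext i
  fin_cases i
  · refine h3.symm.trans ?_
    rw [pow_one]
    rfl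
  · exact ((congrArg _ (map_one _)).trans (mul_one _)).symm

theorem P1.exists_eval₂_eq (b : Γ(P1 k, P1.finitePart k)) :
    ∃ F : MvPolynomial (Fin 2) k, b =
      F.eval₂ (const (P1.toSpec k) (P1.finitePart k)) ![P1.coord k, 1] := by
  have h : Function.Surjective (Proj.awayToSection (grading k) (MvPolynomial.X 1)) := by
    have h1 := Proj.basicOpenIsoAway_hom (grading k) (MvPolynomial.X 1)
      (X_mem_grading k 1) one_pos
    rw [← h1]
    exact (ConcreteCategory.bijective_of_isIso _).2
  obtain ⟨z, rfl⟩ := h b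
  obtain ⟨F, hF⟩ := away_eq_eval₂ k z
  refine ⟨F, ?_⟩
  rw [hF]
  refine (MvPolynomial.eval₂_comp_left
    (Proj.awayToSection (grading k) (MvPolynomial.X 1)).hom _ _ F).trans ?_
  congr 1
  · ext r; exact (P1.const_finitePart k r).symm
  · ext i; fin_cases i
    · rfl
    · exact map_one _

theorem adjoin_grading_zero_range_X : Algebra.adjoin (grading k 0)
    (Set.range (MvPolynomial.X : Fin 2 → MvPolynomial (Fin 2) k)) = ⊤ := by
  refine eq_top_iff.2 fun F _ => ?_
  induction F using MvPolynomial.induction_on with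
  | C a =>
    exact Subalgebra.algebraMap_mem (Algebra.adjoin (grading k 0) _)
      (⟨MvPolynomial.C a, MvPolynomial.isHomogeneous_C _ a⟩ : grading k 0)
  | add p q hp hq => exact add_mem (hp trivial) (hq trivial)
  | mul_X p i hp => exact mul_mem (hp trivial) (Algebra.subset_adjoin ⟨i, rfl⟩)

/-- A relevant homogeneous prime containing X₁ does not contain X₀. A form in it is a multiple of a
power of X₀ modulo X₁, and the coefficient must vanish, so the prime is (X₁). -/
theorem P1.eq_of_notMem_finitePart {x y : P1 k} (hx : x ∉ P1.finitePart k)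
    (hy : y ∉ P1.finitePart k) : x = y := by
  have key (z : Proj (grading k)) (hz : z ∉ Proj.basicOpen (grading k) (MvPolynomial.X 1)) :
      z.asHomogeneousIdeal.toIdeal = Ideal.span {MvPolynomial.X 1} := by
    have h1 : MvPolynomial.X 1 ∈ z.asHomogeneousIdeal.toIdeal := not_not.1 hz
    have hprime : z.asHomogeneousIdeal.toIdeal.IsPrime := z.isPrime
    have h0 : MvPolynomial.X 0 ∉ z.asHomogeneousIdeal.toIdeal := by
      intro h0
      have htop := Proj.iSup_basicOpen_eq_top' (grading k) MvPolynomial.X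
        (fun i => ⟨1, X_mem_grading k i⟩) (adjoin_grading_zero_range_X k)
      obtain ⟨i, hi⟩ := TopologicalSpace.Opens.mem_iSup.1 (htop.ge (Set.mem_univ z))
      fin_cases i
      · exact hi h0
      · exact hz hi
    refine le_antisymm ?_ ((Ideal.span_singleton_le_iff_mem _).2 h1)
    have key' (n : ℕ) (F : MvPolynomial (Fin 2) k) (hF : F.IsHomogeneous n)
        (hFz : F ∈ z.asHomogeneousIdeal.toIdeal) :
        F ∈ Ideal.span {(MvPolynomial.X 1 : MvPolynomial (Fin 2) k)} := by
      rw [← Set.image_singleton, MvPolynomial.mem_ideal_span_X_image]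
      intro d hd
      refine ⟨1, rfl, fun hd1 => ?_⟩
      have hd0 : d = Finsupp.single 0 n := by
        have hw := hF (MvPolynomial.mem_support_iff.1 hd)
        rw [Finsupp.weight_apply, Finsupp.sum_fintype _ _ (by simp)] at hw
        simp [hd1] at hw
        ext i
        fin_cases i
        · simpa using hw
        · simpa using hd1
      have hrest : F - MvPolynomial.monomial d (F.coeff d) ∈
          Ideal.span (MvPolynomial.X '' ({1} : Set (Fin 2))) := by
        rw [MvPolynomial.mem_ideal_span_X_image]
        intro e he
        refine ⟨1, rfl, fun he1 => ?_⟩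
        have hw := hF.sub (MvPolynomial.isHomogeneous_monomial (F.coeff d) (n := n) (by
          rw [hd0, Finsupp.degree_single])) (MvPolynomial.mem_support_iff.1 he)
        rw [Finsupp.weight_apply, Finsupp.sum_fintype _ _ (by simp)] at hw
        simp [he1] at hw
        have : e = d := by
          rw [hd0]
          ext i
          fin_cases i
          · simpa using hw
          · simpa using he1
        exact MvPolynomial.mem_support_iff.1 he (by simp [this])
      rw [Set.image_singleton] at hrest
      have hmon := sub_mem hFz ((Ideal.span_singleton_le_iff_mem _).2 h1 hrest)
      rw [sub_sub_cancel] at hmon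
      have hc := Ideal.mul_mem_left _ (MvPolynomial.C (F.coeff d)⁻¹) hmon
      rw [MvPolynomial.C_mul_monomial, inv_mul_cancel₀ (MvPolynomial.mem_support_iff.1 hd), hd0,
        ← MvPolynomial.X_pow_eq_monomial] at hc
      exact h0 (hprime.mem_of_pow_mem n hc)
    intro F hF
    classical
    rw [← DirectSum.sum_support_decompose (grading k) F]
    exact sum_mem fun n _ => key' n _ (DirectSum.decompose (grading k) F n).2
      (z.asHomogeneousIdeal.isHomogeneous n hF)
  apply ProjectiveSpectrum.ext
  apply HomogeneousIdeal.toIdeal_injective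
  rw [key x hx, key y hy]

end CurvesOverFiniteFields

/-! ### Nonconstant functions -/

namespace CurvesOverFiniteFields

variable (k : Type u) [Field k]

instance : Algebra.FiniteType (grading k 0) (MvPolynomial (Fin 2) k) :=
  ⟨⟨(Set.finite_range _).toFinset, by
    rw [Set.Finite.coe_toFinset]; exact adjoin_grading_zero_range_X k⟩⟩

instance : LocallyOfFiniteType (P1.toSpec k) := by
  have h : Function.Surjective (algebraMap k (grading k 0)) := by
    rintro ⟨F, hF⟩
    have hF' : F.IsHomogeneous 0 := hF
    obtain ⟨a, rfl⟩ : ∃ a, F = MvPolynomial.C a :=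
      ⟨_, MvPolynomial.totalDegree_eq_zero_iff_eq_C.1
        (Nat.le_zero.1 hF'.totalDegree_le)⟩
    exact ⟨a, rfl⟩
  have h1 : LocallyOfFiniteType (Spec.map (CommRingCat.ofHom (algebraMap k (grading k 0)))) :=
    (HasRingHomProperty.Spec_iff (P := @LocallyOfFiniteType)).2 (.of_surjective _ h)
  have h2 : LocallyOfFiniteType (Proj.toSpecZero (grading k)) := inferInstance
  exact MorphismProperty.comp_mem @LocallyOfFiniteType _ _ h2 h1

instance : JacobsonSpace (P1 k) := LocallyOfFiniteType.jacobsonSpace (P1.toSpec k)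

variable {k} {X : Scheme.{u}} {s : X ⟶ Spec (.of k)} {f g : X ⟶ P1 k}

theorem nonempty_finiteLocus [IrreducibleSpace X] (hf : ¬ IsConstant f) (hg : ¬ IsConstant g) :
    Nonempty (finiteLocus f g) := by
  have key (h : X ⟶ P1 k) (hh : ¬ IsConstant h) : (h ⁻¹ᵁ P1.finitePart k : Set X).Nonempty := by
    by_contra hne
    rw [Set.not_nonempty_iff_eq_empty] at hne
    have hx (x : X) : h x ∉ P1.finitePart k := fun hx => by
      have : x ∈ (h ⁻¹ᵁ P1.finitePart k : Set X) := hx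
      simp [hne] at this
    exact hh ⟨h (genericPoint X), fun x => P1.eq_of_notMem_finitePart k (hx x) (hx _)⟩
  obtain ⟨x, hx⟩ := nonempty_preirreducible_inter (f ⁻¹ᵁ P1.finitePart k).2
    (g ⁻¹ᵁ P1.finitePart k).2 (key f hf) (key g hg)
  exact ⟨x, hx⟩

/-- If the coordinate is integral over k, the functions on the affine line land in the integral
closure of k in Γ(X, V), which is a field. Their kernel is then maximal, so V maps to one closed
point, and density of V extends this to X. -/
theorem isConstant_of_isIntegral [IsIntegral X] (hgk : g ≫ P1.toSpec k = s) {V : X.Opens}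
    (hV : IsAffineOpen V) [Nonempty V] (i : V ≤ g ⁻¹ᵁ P1.finitePart k)
    (h : (const s V).IsIntegralElem (g.appLE (P1.finitePart k) V i (P1.coord k))) :
    IsConstant g := by
  let := (const s V).toAlgebra
  let φ := (g.appLE (P1.finitePart k) V i).hom
  have hφk (r : k) : φ (const (P1.toSpec k) _ r) = algebraMap k _ r :=
    appLE_const s (P1.toSpec k) g hgk _ _ i r
  have hφ (b : Γ(P1 k, P1.finitePart k)) : φ b ∈ integralClosure k Γ(X, V) := by
    obtain ⟨F, rfl⟩ := P1.exists_eval₂_eq k b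
    induction F using MvPolynomial.induction_on with
    | C a =>
      rw [MvPolynomial.eval₂_C, hφk]
      exact Subalgebra.algebraMap_mem _ a
    | add p q hp hq =>
      rw [MvPolynomial.eval₂_add, map_add]
      exact add_mem hp hq
    | mul_X p j hp =>
      rw [MvPolynomial.eval₂_mul, MvPolynomial.eval₂_X, map_mul]
      refine mul_mem hp ?_
      fin_cases j
      · exact h
      · exact (map_one φ).symm ▸ one_mem _
  let φ' := φ.codRestrict (integralClosure k Γ(X, V)) hφ
  have hint : φ'.IsIntegral := by
    refine RingHom.IsIntegral.tower_top (const (P1.toSpec k) (P1.finitePart k)) φ' ?_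
    have : φ'.comp (const (P1.toSpec k) (P1.finitePart k)) = algebraMap k _ :=
      RingHom.ext fun r => Subtype.ext (hφk r)
    rw [this]
    exact fun x => Algebra.IsIntegral.isIntegral x
  have hfield : IsField (integralClosure k Γ(X, V)) :=
    isField_of_isIntegral_of_isField' (Field.toIsField k)
  have hbot : (⊥ : Ideal (integralClosure k Γ(X, V))).IsMaximal := by
    let := hfield.toField
    exact Ideal.bot_isMaximal
  have hmax : (RingHom.ker φ).IsMaximal := by
    have := Ideal.isMaximal_comap_of_isIntegral_of_isMaximal' φ' hint ⊥
    convert this using 1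
    ext b
    simp [φ', RingHom.mem_ker, Ideal.mem_comap, Subtype.ext_iff]
  let p : Spec Γ(P1 k, P1.finitePart k) := ⟨RingHom.ker φ, hmax.isPrime⟩
  have hU := P1.isAffineOpen_finitePart k
  have hcl : IsClosed {hU.fromSpec p} := isClosed_singleton_fromSpec hU p hmax
  have hVp (x : X) (hx : x ∈ V) : g x = hU.fromSpec p := by
    have h1 := IsAffineOpen.comap_primeIdealOf_appLE (f := g) _ hU V hV i hx
    have h2 : p = hU.primeIdealOf ⟨g x, i hx⟩ := by
      rw [← h1]
      apply PrimeSpectrum.ext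
      exact hmax.eq_of_le ((hV.primeIdealOf ⟨x, hx⟩).comap φ).2.ne_top
        (Ideal.comap_mono (f := φ) bot_le)
    rw [h2, hU.fromSpec_primeIdealOf]
  refine ⟨hU.fromSpec p, fun x => ?_⟩
  have hdense : Dense (V : Set X) := V.2.dense (by
    obtain ⟨x, hx⟩ := ‹Nonempty V›; exact ⟨x, hx⟩)
  have := (hcl.preimage g.continuous).closure_subset_iff.2 (show (V : Set X) ⊆ _ from hVp)
  exact this (hdense x)

end CurvesOverFiniteFields

/-! ### Torsion units -/

theorem FiniteField.exists_algebraMap_eq_of_frob_eq {k L : Type u} [Field k] [Finite k] [Field L]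
    [Algebra k L] {x : L} (hx : frob k L x = x) : ∃ r, algebraMap k L r = x := by
  have h := eq_periodicField_finrank (⊥ : IntermediateField k L)
  rw [IntermediateField.finrank_bot] at h
  have hx' : x ∈ (⊥ : IntermediateField k L) := by
    rw [h, mem_periodicField]
    exact hx
  exact IntermediateField.mem_bot.1 hx'

namespace CurvesOverFiniteFields

theorem mem_primaryPart_of_map {G H : Type*} [CommGroup G] [CommGroup H] {T : Set Nat.Primes}
    {φ : G →* H} (hφ : Function.Injective φ) {a : G} (ha : φ a ∈ primaryPart T H) :
    a ∈ primaryPart T G :=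
  ⟨hφ.isOfFinOrder_iff.1 ha.1,
    fun ℓ h => ha.2 ℓ (by rwa [orderOf_injective φ hφ])⟩

/-- Bézout splits a root of unity into factors of prime-power order. In characteristic p those of
p-power order are trivial, so omitting p from the generators loses nothing. -/
theorem mem_cyclotomicField_of_pow_eq_one (k : Type*) {kbar : Type*} [Field k] [Field kbar]
    [Algebra k kbar] {T : Set Nat.Primes} {n : ℕ} (hn : 0 < n)
    (hT : ∀ ℓ : Nat.Primes, (ℓ : ℕ) ∣ n → ℓ ∈ T) (u : kbarˣ) (hu : u ^ n = 1) :
    (u : kbar) ∈ cyclotomicField k kbar T := by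
  induction n using Nat.recOnPosPrimePosCoprime generalizing u with
  | zero => exact absurd hn (lt_irrefl 0)
  | one => rw [pow_one] at hu; simp [hu]
  | prime_pow p j hp hj =>
    by_cases hpk : p = ringChar k
    · have : CharP kbar p := by
        have : CharP k p := hpk ▸ ringChar.charP k
        exact charP_of_injective_algebraMap (algebraMap k kbar).injective p
      have : Fact p.Prime := ⟨hp⟩
      have : (u : kbar) = 1 := by
        refine (iterateFrobenius_inj kbar p j) ?_
        rw [iterateFrobenius_def, iterateFrobenius_def, one_pow, ← Units.val_pow_eq_pow_val, hu,
          Units.val_one]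
      rw [this]
      exact one_mem _
    · exact IntermediateField.subset_adjoin k _
        ⟨⟨p, hp⟩, hT ⟨p, hp⟩ (dvd_pow_self p hj.ne'), hpk, j, by
          rw [← Units.val_pow_eq_pow_val, hu, Units.val_one]⟩
  | coprime a b ha hb hab iha ihb =>
    have h1 := ihb (by omega) (fun ℓ h => hT ℓ (h.mul_left a)) (u ^ a) (by rw [← pow_mul, hu])
    have h2 := iha (by omega) (fun ℓ h => hT ℓ (h.mul_right b)) (u ^ b)
      (by rw [← pow_mul, mul_comm, hu])
    have h3 : u = (u ^ a) ^ (a.gcdA b) * (u ^ b) ^ (a.gcdB b) := by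
      rw [← zpow_natCast, ← zpow_natCast, ← zpow_mul, ← zpow_mul, ← zpow_add,
        ← Nat.gcd_eq_gcd_ab, hab.gcd_eq_one]
      simp
    rw [h3, Units.val_mul, Units.val_zpow_eq_zpow_val, Units.val_zpow_eq_zpow_val]
    exact mul_mem (zpow_mem h1 _) (zpow_mem h2 _)

theorem mem_cyclotomicField_of_mem_primaryPart (k : Type*) {kbar : Type*} [Field k] [Field kbar]
    [Algebra k kbar] {T : Set Nat.Primes} {u : kbarˣ} (hu : u ∈ primaryPart T kbarˣ) :
    (u : kbar) ∈ cyclotomicField k kbar T :=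
  mem_cyclotomicField_of_pow_eq_one k hu.1.orderOf_pos hu.2 u (pow_orderOf_eq_one u)

/-! ### Descent and the pointwise criterion -/

section

variable {k : Type u} [Field k] {X : Scheme.{u}} (s : X ⟶ Spec (.of k))
  (kbar : Type u) [Field kbar] [Algebra k kbar]

/-- If b dies on the fibre, surjectivity of the projection makes its nonvanishing locus empty, and b
= 0 because X is reduced. -/
theorem geomFibre.app_injective [IsReduced X] (U : X.Opens) :
    Function.Injective ((geomFibre.proj s kbar).app U) := by
  have hsurj : Surjective (geomFibre.proj s kbar) :=
    inferInstanceAs (Surjective (pullback.fst s _))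
  refine (injective_iff_map_eq_zero ((geomFibre.proj s kbar).app U).hom).2 fun b hb => ?_
  rw [← basicOpen_eq_bot_iff]
  have h : geomFibre.proj s kbar ⁻¹ᵁ X.basicOpen b = ⊥ := by
    rw [Scheme.preimage_basicOpen]
    refine (congrArg _ hb).trans ?_
    exact (Scheme.basicOpen_zero _ _)
  ext x
  obtain ⟨y, rfl⟩ := (geomFibre.proj s kbar).surjective x
  exact (SetLike.ext_iff.1 h y)

theorem geomFibre.ringHom_apply_eq {U V : X.Opens} (hV : IsAffineOpen V) (i : V ≤ U)
    {F G : Γ(X, U)} {a c : kbar} {m : ℕ}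
    (h : (geomFibre.proj s kbar).app U F = const (geomFibre.toSpec s kbar) _ a *
      (1 + const (geomFibre.toSpec s kbar) _ c * (geomFibre.proj s kbar).app U G) ^ m)
    (ψ : Γ(X, V) →+* kbar) (hψ : ψ.comp (const s V) = algebraMap k kbar) :
    ψ (X.presheaf.map (homOfLE i).op F) =
      a * (1 + c * ψ (X.presheaf.map (homOfLE i).op G)) ^ m := by
  obtain ⟨Ψ, hΨ, hΨψ⟩ := geomFibre.exists_ringHom s kbar hV ψ hψ
  rw [← hΨψ, ← hΨψ, ← geomFibre.map_app, ← geomFibre.map_app, h]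
  simp only [map_mul, map_pow, map_add, map_one]
  have (r : kbar) := map_const (geomFibre.toSpec s kbar)
    (show geomFibre.proj s kbar ⁻¹ᵁ V ≤ geomFibre.proj s kbar ⁻¹ᵁ U from fun _ hx => i hx) r
  rw [this, this, hΨ, hΨ]

end

section

variable {k : Type u} [Field k] {kbar : Type u} [Field kbar] [Algebra k kbar]
  {X : Scheme.{u}} {s : X ⟶ Spec (.of k)} {f g : X ⟶ P1 k} {m : ℕ} {S : Set Nat.Primes}

theorem exists_isAffineOpen_le {U : X.Opens} (hU : Nonempty U) :
    ∃ V : X.Opens, IsAffineOpen V ∧ Nonempty V ∧ V ≤ U := by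
  obtain ⟨x, hx⟩ := hU
  obtain ⟨V, hV, hxV, hVU⟩ := TopologicalSpace.Opens.isBasis_iff_nbhd.1 X.isBasis_affineOpens hx
  exact ⟨V, hV, ⟨x, hxV⟩, hVU⟩

theorem not_isIntegralElem_sndFun [IsIntegral X] (hgk : g ≫ P1.toSpec k = s)
    (hg : ¬ IsConstant g) {V : X.Opens} (hV : IsAffineOpen V) (hVn : Nonempty V)
    (i : V ≤ finiteLocus f g) :
    ¬ (const s V).IsIntegralElem (X.presheaf.map (homOfLE i).op (sndFun f g)) := by
  intro h
  refine hg (isConstant_of_isIntegral hgk hV (i.trans inf_le_right) ?_)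
  have h1 := congr($(g.appLE_map (U := P1.finitePart k) (V := finiteLocus f g) inf_le_right
    (homOfLE i).op).hom (P1.coord k))
  exact (show _ = _ from h1) ▸ h

theorem PropPbar.propP [Finite k] [IsAlgClosure k kbar] [IsIntegral X] [LocallyOfFiniteType s]
    (hgk : g ≫ P1.toSpec k = s)
    (hf : ¬ IsConstant f) (hg : ¬ IsConstant g) (hm : 0 < m) (h : PropPbar f g s kbar S m) :
    PropP f g s S m := by
  obtain ⟨a, ha, c, hc, h⟩ := h
  have : IsAlgClosed kbar := IsAlgClosure.isAlgClosed k
  have : Algebra.IsAlgebraic k kbar := IsAlgClosure.isAlgebraic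
  obtain ⟨V, hV, hVn, i⟩ := exists_isAffineOpen_le (nonempty_finiteLocus hf hg)
  let := (const s V).toAlgebra
  have : Algebra.FiniteType k Γ(X, V) := finiteType_const s hV
  let G := X.presheaf.map (homOfLE i).op (sndFun f g)
  have hG : Transcendental k G := by
    rw [Transcendental, isAlgebraic_iff_isIntegral]
    exact not_isIntegralElem_sndFun hgk hg hV hVn i
  have key (φ : Γ(X, V) →ₐ[k] kbar) :=
    geomFibre.ringHom_apply_eq s kbar hV i h φ.toRingHom φ.comp_algebraMap
  have hinf := (FiniteField.infinite_range_algHom_apply (L := kbar) hG).image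
    (FiniteField.frob k kbar).injective.injOn
  -- The value of f at the point Frob ∘ φ is computed twice: from the relation there, and by
  -- applying Frobenius to the relation at φ. Comparing over infinitely many values of g shows that
  -- a and c are Frobenius-fixed.
  obtain ⟨h1, h2⟩ := FiniteField.eq_of_infinite_setOf_eq_linearPow (L := kbar)
    (a' := FiniteField.frob k kbar a) (c' := FiniteField.frob k kbar c) hm a.ne_zero c.ne_zero hinf
    (by
      rintro _ ⟨_, ⟨φ, rfl⟩, rfl⟩
      refine (key ((FiniteField.frob k kbar).comp φ)).symm.trans
        ((congrArg (FiniteField.frob k kbar) (key φ)).trans ?_)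
      simp only [map_mul, map_pow, map_add, map_one]
      rfl)
  have hunit (b : kbarˣ) (hb : b ∈ primaryPart Sᶜ kbarˣ) (h : FiniteField.frob k kbar b = b) :
      ∃ b₀ ∈ primaryPart Sᶜ kˣ, algebraMap k kbar (b₀ : k) = b := by
    obtain ⟨r, hr⟩ := FiniteField.exists_algebraMap_eq_of_frob_eq h
    have hr0 : r ≠ 0 := by
      rintro rfl
      exact b.ne_zero (by rw [← hr, map_zero])
    refine ⟨Units.mk0 r hr0, mem_primaryPart_of_map
      (φ := Units.map (algebraMap k kbar).toMonoidHom)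
      (Units.map_injective (algebraMap k kbar).injective) ?_, hr⟩
    convert hb
    exact Units.ext hr
  obtain ⟨a₀, ha₀, ha⟩ := hunit a ha h1.symm
  obtain ⟨c₀, hc₀, hc⟩ := hunit c hc h2.symm
  refine ⟨a₀, ha₀, c₀, hc₀, geomFibre.app_injective s kbar _ ?_⟩
  rw [h, map_mul, map_pow, map_add, map_mul, map_one, geomFibre.app_const, geomFibre.app_const,
    ha, hc]

theorem PropQbar.propPbar [Finite k] [IsAlgClosure k kbar] [SmoothOfRelativeDimension 1 s]
    [GeometricallyConnected s] [IsIntegral X] [LocallyOfFiniteType s]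
    (hgk : g ≫ P1.toSpec k = s) (hf : ¬ IsConstant f) (hg : ¬ IsConstant g) (hm : 0 < m)
    (hS : IsLarge k kbar S) (h : PropQbar f g s kbar S m) : PropPbar f g s kbar S m := by
  have : IsAlgClosed kbar := IsAlgClosure.isAlgClosed k
  have : Algebra.IsAlgebraic k kbar := IsAlgClosure.isAlgebraic
  have : JacobsonSpace X := LocallyOfFiniteType.jacobsonSpace s
  obtain ⟨V, hV, hVn, i⟩ := exists_isAffineOpen_le (nonempty_finiteLocus hf hg)
  let := (const s V).toAlgebra
  have : Algebra.FiniteType k Γ(X, V) := finiteType_const s hV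
  let F := X.presheaf.map (homOfLE i).op (fstFun f g)
  let G := X.presheaf.map (homOfLE i).op (sndFun f g)
  have hG : Transcendental k G := by
    rw [Transcendental, isAlgebraic_iff_isIntegral]
    exact not_isIntegralElem_sndFun hgk hg hV hVn i
  have hinj : Function.Injective hV.fromSpec := hV.fromSpec.isOpenEmbedding.injective
  -- The admissible constants all lie in the cyclotomic field of Sᶜ, which is proper because S is
  -- k-large.
  let T : Set kbar := Units.val '' (primaryPart Sᶜ kbarˣ : Set kbarˣ)
  obtain ⟨_, ⟨a, ha, rfl⟩, _, ⟨c, hc, rfl⟩, hac⟩ :=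
    FiniteField.exists_infinite_setOf_algHom (L := kbar) (F := F) (G := G) (T := T) hG hS
      (by
        rintro _ ⟨u, hu, rfl⟩
        exact mem_cyclotomicField_of_mem_primaryPart k hu)
      (by
        rintro ⟨u, -, hu⟩
        exact u.ne_zero hu) hm
      (bad := PrimeSpectrum.asIdeal '' (hV.fromSpec ⁻¹' {x : X | IsClosed {x} ∧
        ∃ hx : x ∈ finiteLocus f g, ¬ RelAt f g s kbar S m x hx}))
      ((h.preimage hinj.injOn).image _)
      (by
        intro φ hφ
        have hmax : (RingHom.ker φ).IsMaximal := by
          refine Ideal.isMaximal_comap_of_isIntegral_of_isMaximal' φ.toRingHom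
            (RingHom.IsIntegral.tower_top (algebraMap k _) _ ?_) ⊥
          rw [AlgHom.toRingHom_eq_coe, AlgHom.comp_algebraMap]
          exact fun x => Algebra.IsIntegral.isIntegral x
        let p : Spec Γ(X, V) := ⟨RingHom.ker φ, hmax.isPrime⟩
        have hxV : hV.fromSpec p ∈ V := by
          have : hV.fromSpec p ∈ Set.range hV.fromSpec := ⟨p, rfl⟩
          rwa [hV.range_fromSpec] at this
        have hrel : RelAt f g s kbar S m (hV.fromSpec p) (i hxV) := by
          by_contra hrel
          exact hφ ⟨p, ⟨isClosed_singleton_fromSpec hV p hmax, i hxV, hrel⟩, rfl⟩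
        obtain ⟨ι, hι, a, ha, c, hc, hac⟩ := hrel
        rw [toResidue_congr s _ V _ (i hxV) hxV] at hι
        -- The embedding ι supplied by the pointwise relation may differ from the one underlying φ,
        -- so only the kernel of φ is retained.
        let ψ : Γ(X, V) →ₐ[k] kbar :=
          { ι.comp (X.evaluation V _ hxV).hom with commutes' := fun r => congr($hι r) }
        have hψ (b : Γ(X, finiteLocus f g)) : ψ (X.presheaf.map (homOfLE i).op b) =
            ι (X.evaluation _ _ (i hxV) b) := congrArg ι (evaluation_map i _ hxV b)
        refine ⟨ψ, ?_, a, ⟨a, ha, rfl⟩, c, ⟨c, hc, rfl⟩, ?_⟩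
        · have h1 : RingHom.ker ψ = RingHom.ker (X.evaluation V _ hxV).hom := by
            ext b
            exact map_eq_zero ι
          rw [h1, ker_evaluation hV]
          exact congrArg PrimeSpectrum.asIdeal (hinj (hV.fromSpec_primeIdealOf _))
        · rw [hψ, hψ]
          exact hac)
  refine ⟨a, ha, c, hc, geomFibre.eq_of_eq_map s kbar i hVn
    (geomFibre.eq_of_infinite s kbar hV F G a c m ?_)⟩
  refine (hac.image (f := AlgHom.toRingHom) fun φ _ φ' _ hφ => AlgHom.ext fun b => congr($hφ b)).mono
    ?_
  rintro _ ⟨φ, hφ, rfl⟩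
  exact ⟨φ.comp_algebraMap, hφ⟩

end

end CurvesOverFiniteFields

theorem mainTheorem3 {k : Type u} [Field k] [Finite k]
    (kbar : Type u) [Field kbar] [Algebra k kbar] [IsAlgClosure k kbar]
    {X : Scheme.{u}} (s : X ⟶ Spec (.of k))
    [IsProper s] [SmoothOfRelativeDimension 1 s] [GeometricallyConnected s]
    (f g : X ⟶ CurvesOverFiniteFields.P1 k)
    (hfk : f ≫ CurvesOverFiniteFields.P1.toSpec k = s)
    (hgk : g ≫ CurvesOverFiniteFields.P1.toSpec k = s)
    (hf : ¬ CurvesOverFiniteFields.IsConstant f)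
    (hg : ¬ CurvesOverFiniteFields.IsConstant g)
    (m : ℕ) (hm : 0 < m) (S : Set Nat.Primes) :
    ((CurvesOverFiniteFields.PropP f g s S m ↔
        CurvesOverFiniteFields.PropPbar f g s kbar S m) ∧
      (CurvesOverFiniteFields.PropPbar f g s kbar S m →
        CurvesOverFiniteFields.PropQbar f g s kbar S m)) ∧
    (CurvesOverFiniteFields.IsLarge k kbar S →
      CurvesOverFiniteFields.PropQbar f g s kbar S m →
        CurvesOverFiniteFields.PropPbar f g s kbar S m) := by
  have : ConnectedSpace X :=
    have : Subsingleton (Spec (.of k)) := inferInstanceAs (Subsingleton (PrimeSpectrum k))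
    have : Nonempty (Spec (.of k)) := inferInstanceAs (Nonempty (PrimeSpectrum k))
    GeometricallyConnected.connectedSpace_of_subsingleton s
  have : IsIntegral X := SmoothOfRelativeDimension.isIntegral s
  have : IsAlgClosed kbar := IsAlgClosure.isAlgClosed k
  exact ⟨⟨⟨fun h => h.propPbar kbar, fun h => h.propP hgk hf hg hm⟩,
    fun h => (h.propP hgk hf hg hm).propQbar s⟩, fun hS h => h.propPbar hgk hf hg hm hS⟩
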